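/- Let $p>1$ be an odd integer and $c_0:=\frac{2(p+1)}{(p-1)^2}$. Let $\mathcal H:=L^2(0,1)^2$ be the complex Hilbert space with norm $\|\mathbf u\|^2=\|u_1\|_{L^2(0,1)}^2+\|u_2\|_{L^2(0,1)}^2$, and let $\tilde L_0$ be the linear operator in $\mathcal H$ with domain $$\mathcal D(\tilde L_0):=\{\mathbf u=(u_1,u_2)\in C^1[0,1]^2:\ u_1(0)=0\},\qquad \tilde L_0\mathbf u:=\bigl(-\rho u_1'+u_2',\ u_1'-\rho u_2'\bigr).$$ For $\mathbf u\in\mathcal H$ put $$L'\mathbf u(\rho):=\Bigl(p\,c_0\int_0^\rho u_2(\xi)\,d\xi,\ 0\Bigr).$$ Then $\tilde L_0$ is closable; $L'$ is a bounded linear operator on $\mathcal H$ with $\|L'\|\le p\,c_0$; and, with $L_0$ denoting the closure of $\tilde L_0$, the operator $L:=L_0+L'$ with domain $\mathcal D(L):=\mathcal D(L_0)$ is the infinitesimal generator of a strongly continuous one-parameter semigroup $S:[0,\infty)\to\mathcal B(\mathcal H)$ satisfying $$\|S(\tau)\|\le e^{(\frac12+p c_0)\tau}\qquad\text{for all }\tau\ge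 0.$$ -/

import Mathlib

open MeasureTheory Set Filter Topology
open scoped NNReal ENNReal

noncomputable section

namespace SelfSimilarWave

/-- Lebesgue measure on the interval `(0,1)`. -/
abbrev μI : Measure ℝ := volume.restrict (Ioo (0 : ℝ) 1)

/-- The complex Hilbert space `L²(0,1)`. -/
abbrev L2I : Type := Lp ℂ 2 μI

/-- The Hilbert space `H = L²(0,1)²`, with norm `‖u‖² = ‖u₁‖² + ‖u₂‖²`. -/
abbrev H : Type := WithLp 2 (L2I × L2I)

/-- `v ∈ C¹[0,1]`, with one-sided derivatives at the end points. -/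
def IsC1 (v : ℝ → ℂ) : Prop := ContDiffOn ℝ 1 v (Icc 0 1)

/-- The derivative on `[0,1]`, one-sided at the end points. -/
def dI (v : ℝ → ℂ) (ρ : ℝ) : ℂ := derivWithin v (Icc 0 1) ρ

lemma IsC1.differentiableWithinAt {v : ℝ → ℂ} (hv : IsC1 v) {ρ : ℝ} (hρ : ρ ∈ Ioo (0 : ℝ) 1) :
    DifferentiableWithinAt ℝ v (Icc 0 1) ρ :=
  hv.differentiableOn (by norm_num) ρ (Ioo_subset_Icc_self hρ)

lemma dI_add {v w : ℝ → ℂ} (hv : IsC1 v) (hw : IsC1 w) {ρ : ℝ} (hρ : ρ ∈ Ioo (0 : ℝ) 1) :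
    dI (v + w) ρ = dI v ρ + dI w ρ :=
  derivWithin_add (hv.differentiableWithinAt hρ) (hw.differentiableWithinAt hρ)

lemma dI_smul (c : ℂ) {v : ℝ → ℂ} (hv : IsC1 v) {ρ : ℝ} (hρ : ρ ∈ Ioo (0 : ℝ) 1) :
    dI (c • v) ρ = c * dI v ρ := by
  unfold dI
  exact derivWithin_const_smul c (hv.differentiableWithinAt hρ)

/-- A `C¹` function which vanishes almost everywhere has vanishing derivative. -/
lemma dI_eq_zero {v : ℝ → ℂ} (hv : IsC1 v) (h0 : v =ᵐ[μI] 0) {ρ : ℝ} (hρ : ρ ∈ Ioo (0 : ℝ) 1) :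
    dI v ρ = 0 := by
  have h1 : EqOn v 0 (Ioo 0 1) :=
    Measure.eqOn_open_of_ae_eq h0 isOpen_Ioo
      (hv.continuousOn.mono Ioo_subset_Icc_self) continuousOn_const
  have h2 : v =ᶠ[𝓝 ρ] fun _ => (0 : ℂ) := by
    filter_upwards [isOpen_Ioo.mem_nhds hρ] with x hx using h1 hx
  unfold dI
  rw [derivWithin_of_mem_nhds (Icc_mem_nhds hρ.1 hρ.2), h2.deriv_eq]
  simp

/-- The graph of the operator `L̃₀ u = (-ρ u₁' + u₂', u₁' - ρ u₂')` with domain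
`{u ∈ C¹[0,1]² : u₁(0) = 0}`: the set of pairs `(u, f)` in `H × H` such that `u` has a
`C¹` representative `(v₁, v₂)` with `v₁(0) = 0`, and `f = L̃₀ u`. -/
def preGraph : Submodule ℂ (H × H) where
  carrier := {x | ∃ v₁ v₂ : ℝ → ℂ, IsC1 v₁ ∧ IsC1 v₂ ∧ v₁ 0 = 0 ∧
    x.1.fst =ᵐ[μI] v₁ ∧ x.1.snd =ᵐ[μI] v₂ ∧
    (x.2.fst =ᵐ[μI] fun ρ => -(ρ : ℂ) * dI v₁ ρ + dI v₂ ρ) ∧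
    (x.2.snd =ᵐ[μI] fun ρ => dI v₁ ρ - (ρ : ℂ) * dI v₂ ρ)}
  zero_mem' := by
    have hz : IsC1 0 := contDiffOn_const
    have hd : ∀ ρ, dI 0 ρ = 0 := fun ρ => by simp [dI]
    refine ⟨0, 0, hz, hz, rfl, ?_, ?_, ?_, ?_⟩
    · exact Lp.coeFn_zero _ _ _
    · exact Lp.coeFn_zero _ _ _
    · filter_upwards [Lp.coeFn_zero ℂ 2 μI] with ρ h
      simpa [hd] using h
    · filter_upwards [Lp.coeFn_zero ℂ 2 μI] with ρ h
      simpa [hd] using h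
  add_mem' := by
    rintro x y ⟨v₁, v₂, h1, h2, h3, h4, h5, h6, h7⟩ ⟨w₁, w₂, k1, k2, k3, k4, k5, k6, k7⟩
    refine ⟨v₁ + w₁, v₂ + w₂, h1.add k1, h2.add k2, by simp [h3, k3], ?_, ?_, ?_, ?_⟩
    · exact (Lp.coeFn_add x.1.fst y.1.fst).trans (h4.add k4)
    · exact (Lp.coeFn_add x.1.snd y.1.snd).trans (h5.add k5)
    · filter_upwards [Lp.coeFn_add x.2.fst y.2.fst, h6, k6, ae_restrict_mem measurableSet_Ioo]
        with ρ a b c hρ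
      refine a.trans ?_
      rw [Pi.add_apply, b, c, dI_add h1 k1 hρ, dI_add h2 k2 hρ]
      ring
    · filter_upwards [Lp.coeFn_add x.2.snd y.2.snd, h7, k7, ae_restrict_mem measurableSet_Ioo]
        with ρ a b c hρ
      refine a.trans ?_
      rw [Pi.add_apply, b, c, dI_add h1 k1 hρ, dI_add h2 k2 hρ]
      ring
  smul_mem' := by
    rintro z x ⟨v₁, v₂, h1, h2, h3, h4, h5, h6, h7⟩
    refine ⟨z • v₁, z • v₂, h1.const_smul z, h2.const_smul z, by simp [h3], ?_, ?_, ?_, ?_⟩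
    · exact (Lp.coeFn_smul z x.1.fst).trans (h4.const_smul z)
    · exact (Lp.coeFn_smul z x.1.snd).trans (h5.const_smul z)
    · filter_upwards [Lp.coeFn_smul z x.2.fst, h6, ae_restrict_mem measurableSet_Ioo]
        with ρ a b hρ
      refine a.trans ?_
      rw [Pi.smul_apply, b, dI_smul z h1 hρ, dI_smul z h2 hρ, smul_eq_mul]
      ring
    · filter_upwards [Lp.coeFn_smul z x.2.snd, h7, ae_restrict_mem measurableSet_Ioo]
        with ρ a b hρ
      refine a.trans ?_
      rw [Pi.smul_apply, b, dI_smul z h1 hρ, dI_smul z h2 hρ, smul_eq_mul]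
      ring

/-- `preGraph` is the graph of a (single-valued) operator. -/
lemma preGraph_single (x : H × H) (hx : x ∈ preGraph) (h0 : x.1 = 0) : x.2 = 0 := by
  obtain ⟨v₁, v₂, h1, h2, h3, h4, h5, h6, h7⟩ := hx
  have e1 : v₁ =ᵐ[μI] 0 := by
    rw [h0] at h4
    exact h4.symm.trans (Lp.coeFn_zero _ _ _)
  have e2 : v₂ =ᵐ[μI] 0 := by
    rw [h0] at h5
    exact h5.symm.trans (Lp.coeFn_zero _ _ _)
  have a1 : x.2.fst = 0 := by
    refine (Lp.eq_zero_iff_ae_eq_zero).2 ?_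
    filter_upwards [h6, ae_restrict_mem measurableSet_Ioo] with ρ a hρ
    rw [a, dI_eq_zero h1 e1 hρ, dI_eq_zero h2 e2 hρ]
    simp
  have a2 : x.2.snd = 0 := by
    refine (Lp.eq_zero_iff_ae_eq_zero).2 ?_
    filter_upwards [h7, ae_restrict_mem measurableSet_Ioo] with ρ a hρ
    rw [a, dI_eq_zero h1 e1 hρ, dI_eq_zero h2 e2 hρ]
    simp
  have a3 : WithLp.ofLp x.2 = 0 := Prod.ext a1 a2
  exact (WithLp.ofLp_eq_zero 2).1 a3

/-- The unbounded operator `L̃₀` in `H`. -/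
def preFreeOp : H →ₗ.[ℂ] H := preGraph.toLinearPMap

/-- The graph of `L̃₀` is `preGraph`. -/
lemma preFreeOp_graph : preFreeOp.graph = preGraph :=
  Submodule.toLinearPMap_graph_eq _ preGraph_single

/-- The closure `L₀` of `L̃₀`. -/
def freeOp : H →ₗ.[ℂ] H := preFreeOp.closure

lemma L2I.integrableOn (f : L2I) : IntegrableOn f (Ioc (0 : ℝ) 1) := by
  rw [integrableOn_Ioc_iff_integrableOn_Ioo]
  exact (Lp.memLp f).integrable (by norm_num)

lemma L2I.intervalIntegrable (f : L2I) {ρ : ℝ} (hρ : ρ ∈ Ioo (0 : ℝ) 1) :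
    IntervalIntegrable f volume 0 ρ := by
  rw [intervalIntegrable_iff_integrableOn_Ioc_of_le hρ.1.le]
  exact (L2I.integrableOn f).mono_set (Ioc_subset_Ioc_right hρ.2.le)

/-- `ρ ↦ ∫₀^ρ f` belongs to `L²(0,1)` for `f ∈ L²(0,1)`. -/
lemma L2I.memLp_primitive (f : L2I) : MemLp (fun ρ : ℝ => ∫ ξ in (0 : ℝ)..ρ, f ξ) 2 μI := by
  have hc : ContinuousOn (fun ρ : ℝ => ∫ ξ in (0 : ℝ)..ρ, f ξ) (Icc 0 1) := by
    have hi : IntegrableOn f (uIcc (0 : ℝ) 1) := by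
      rw [uIcc_of_le zero_le_one]
      exact (integrableOn_Icc_iff_integrableOn_Ioc (μ := volume)).2 (L2I.integrableOn f)
    rw [← uIcc_of_le (zero_le_one' ℝ)]
    exact intervalIntegral.continuousOn_primitive_interval hi
  obtain ⟨C, hC⟩ := isCompact_Icc.exists_bound_of_continuousOn hc
  refine MemLp.of_bound
    ((hc.mono Ioo_subset_Icc_self).aestronglyMeasurable measurableSet_Ioo) C ?_
  filter_upwards [ae_restrict_mem measurableSet_Ioo] with ρ hρ
  exact hC ρ (Ioo_subset_Icc_self hρ)

/-- The linear map `f ↦ (ρ ↦ ∫₀^ρ f(ξ) dξ)` on `L²(0,1)`. -/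
def primitive : L2I →ₗ[ℂ] L2I where
  toFun f := (L2I.memLp_primitive f).toLp _
  map_add' f g := by
    rw [← MemLp.toLp_add]
    refine MemLp.toLp_congr _ _ ?_
    filter_upwards [ae_restrict_mem measurableSet_Ioo] with ρ hρ
    rw [Pi.add_apply, ← intervalIntegral.integral_add (L2I.intervalIntegrable f hρ)
      (L2I.intervalIntegrable g hρ), intervalIntegral.integral_of_le hρ.1.le,
      intervalIntegral.integral_of_le hρ.1.le]
    have h := ae_restrict_of_ae_restrict_of_subset (Ioo_subset_Ioo_right hρ.2.le)
      (Lp.coeFn_add f g)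
    rw [restrict_Ioo_eq_restrict_Ioc] at h
    exact integral_congr_ae h
  map_smul' c f := by
    rw [RingHom.id_apply, ← MemLp.toLp_const_smul]
    refine MemLp.toLp_congr _ _ ?_
    filter_upwards [ae_restrict_mem measurableSet_Ioo] with ρ hρ
    rw [Pi.smul_apply, ← intervalIntegral.integral_smul, intervalIntegral.integral_of_le hρ.1.le,
      intervalIntegral.integral_of_le hρ.1.le]
    have h := ae_restrict_of_ae_restrict_of_subset (Ioo_subset_Ioo_right hρ.2.le)
      (Lp.coeFn_smul c f)
    rw [restrict_Ioo_eq_restrict_Ioc] at h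
    exact integral_congr_ae h

/-- The constant `c₀ = 2(p+1)/(p-1)²`. -/
def c₀ (p : ℕ) : ℝ := 2 * ((p : ℝ) + 1) / ((p : ℝ) - 1) ^ 2

/-- The linear map `L' u = (p c₀ ∫₀^ρ u₂(ξ) dξ, 0)` on `H`. -/
def pertOp (p : ℕ) : H →ₗ[ℂ] H where
  toFun u := WithLp.toLp 2 ((((p : ℝ) * c₀ p : ℝ) : ℂ) • primitive u.snd, 0)
  map_add' u v := by
    refine congrArg (WithLp.toLp 2) (Prod.ext ?_ (add_zero (0 : L2I)).symm)
    change _ • primitive (u.snd + v.snd) = _ • primitive u.snd + _ • primitive v.snd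
    rw [map_add, smul_add]
  map_smul' c u := by
    refine congrArg (WithLp.toLp 2) (Prod.ext ?_ (smul_zero c).symm)
    change _ • primitive (c • u.snd) = c • _ • primitive u.snd
    rw [map_smul, smul_comm]

/-- The operator `L = L₀ + L'`, with domain that of `L₀`. -/
def linOp (p : ℕ) : H →ₗ.[ℂ] H := pertOp p +ᵥ freeOp

/-- `S : [0,∞) → B(E)` is a strongly continuous one-parameter semigroup. -/
structure IsC0Semigroup {E : Type*} [NormedAddCommGroup E] [NormedSpace ℂ E]
    (S : ℝ≥0 → E →L[ℂ] E) : Prop where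
  map_zero : S 0 = ContinuousLinearMap.id ℂ E
  map_add : ∀ s t, S (s + t) = (S s).comp (S t)
  continuous : ∀ x, Continuous fun t => S t x

/-- `A` is the infinitesimal generator of `S`: `x` belongs to the domain of `A` and `A x = y` if
and only if `(S(h)x - x)/h → y` as `h → 0+`. -/
def IsGenerator {E : Type*} [NormedAddCommGroup E] [NormedSpace ℂ E]
    (A : E →ₗ.[ℂ] E) (S : ℝ≥0 → E →L[ℂ] E) : Prop :=
  ∀ x y : E, (x, y) ∈ A.graph ↔
    Tendsto (fun h : ℝ≥0 => (((h : ℝ) : ℂ))⁻¹ • (S h x - x)) (𝓝[>] 0) (𝓝 y)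

end SelfSimilarWave

end

/-!
The theorem is the Hille–Yosida theorem applied to `L = L₀ + L'`; operators are given by their
graphs, as subspaces of `E × E`.

*Dissipativity.* For `u ∈ D(L̃₀)`, `Re ((L̃₀ u - u / 2) · ū)` is the derivative of
`-ρ (|u₁|² + |u₂|²) / 2 + Re (ū₁ u₂)`, so that integration over `(0,1)` and `u₁(0) = 0` give
`Re ⟪L̃₀ u, u⟫ = ‖u‖² / 2 - |u₁(1) - u₂(1)|² / 2` (`re_inner_le_of_mem_preGraph`). In a form which
only involves norms this is `IsQuasiDissipative`: `(r - ω) ‖x‖ ≤ ‖(r - A) x‖` for all `r > ω`, here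
with `ω = 1 / 2`. This property passes to the closure of the graph; together with density of the
domain it makes the operator closable (`IsQuasiDissipative.eq_zero_of_mem_topologicalClosure`), and
together with density of the range of `r - A` it makes `r - Ā` onto
(`IsQuasiDissipative.exists_of_dense_range`).

*Range.* In the characteristic variables `w± = u₁ ± u₂` the equation `(n - L̃₀) u = f` decouples
into `n w₊ - (1 - ρ) w₊' = f₊` and `n w₋ + (1 + ρ) w₋' = f₋`. For a positive integer `n` and `f` built
from a test function, both are solved explicitly by `C¹` functions: `w₊` vanishes near the singular
point `ρ = 1`, and the free initial value of `w₋` is used to satisfy `u₁(0) = 0`. As functions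
orthogonal to all test functions vanish, the range is dense (`dense_range_preGraph`).

*Perturbation.* Since `‖L'‖ ≤ p c₀`, the operator `L` is quasi-dissipative with constant
`1 / 2 + p c₀`, and `n - L` is onto for `n > 1 / 2 + p c₀` by a Neumann series
(`IsQuasiDissipative.exists_of_perturbation`).

*Generation.* `exists_c0Semigroup_of_isQuasiDissipative` constructs the semigroup as the strong
limit of `exp (t B_n)`, where `B_n = n² (n - L)⁻¹ - n` are the Yosida approximations. These operators
commute, which bounds `‖exp (t B_n) x - exp (t B_m) x‖` by a multiple of `‖B_n x - B_m x‖`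
(`norm_expSG_sub_le`), and they converge to `L` on its domain.
-/

namespace SelfSimilarWave

/-! ### Exponentials of bounded operators -/

section BoundedExponential

variable {E : Type*} [NormedAddCommGroup E] [NormedSpace ℂ E]

/-- The uniformly continuous semigroup `t ↦ e^{tB}` generated by a bounded operator `B`. -/
noncomputable def expSG (B : E →L[ℂ] E) (t : ℝ) : E →L[ℂ] E := NormedSpace.exp (t • B)

lemma hasDerivAt_apply {T : ℝ → E →L[ℂ] E} {T' : E →L[ℂ] E} {s : ℝ} (h : HasDerivAt T T' s)
    (x : E) : HasDerivAt (fun s => T s x) (T' x) s :=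
  ((ContinuousLinearMap.apply ℂ E x).restrictScalars ℝ).hasFDerivAt.comp_hasDerivAt s h

lemma expSG_zero (B : E →L[ℂ] E) : expSG B 0 = 1 := by
  simp [expSG, NormedSpace.exp_zero]

lemma expSG_comm {B C : E →L[ℂ] E} (h : Commute B C) (s : ℝ) : Commute (expSG B s) C :=
  (h.smul_left s).exp_left

variable [CompleteSpace E]

lemma norm_exp_le (T : E →L[ℂ] E) : ‖NormedSpace.exp T‖ ≤ Real.exp ‖T‖ := by
  have h1 : HasSum (fun n : ℕ => ((Nat.factorial n : ℝ)⁻¹) • ‖T‖ ^ n) (Real.exp ‖T‖) := by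
    rw [Real.exp_eq_exp_ℝ]
    exact NormedSpace.exp_series_hasSum_exp' (𝕂 := ℝ) ‖T‖
  have h2 := NormedSpace.exp_series_hasSum_exp' (𝕂 := ℝ) T
  rw [← h2.tsum_eq]
  refine tsum_of_norm_bounded h1 fun n => ?_
  rw [norm_smul, norm_inv, Real.norm_natCast, smul_eq_mul]
  gcongr
  rcases Nat.eq_zero_or_pos n with rfl | hn
  · rw [pow_zero, pow_zero]
    exact ContinuousLinearMap.norm_id_le
  · exact norm_pow_le' T hn

lemma hasDerivAt_expSG (B : E →L[ℂ] E) (t : ℝ) : HasDerivAt (expSG B) (expSG B t * B) t :=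
  hasDerivAt_exp_smul_const B t

/-- `NormedSpace.exp_add_of_commute` for operators, whose `ℚ`-algebra structure is not an
instance. -/
lemma exp_add_of_commute' {A B : E →L[ℂ] E} (h : Commute A B) :
    NormedSpace.exp (A + B) = NormedSpace.exp A * NormedSpace.exp B :=
  let _ : NormedAlgebra ℚ (E →L[ℂ] E) := NormedAlgebra.restrictScalars ℚ ℂ _
  NormedSpace.exp_add_of_commute h

lemma expSG_add (B : E →L[ℂ] E) (s t : ℝ) : expSG B (s + t) = expSG B s * expSG B t := by
  rw [expSG, add_smul, exp_add_of_commute' (((Commute.refl B).smul_left s).smul_right t)]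
  rfl

lemma expSG_continuous (B : E →L[ℂ] E) : Continuous (expSG B) :=
  continuous_iff_continuousAt.2 fun t => (hasDerivAt_expSG B t).continuousAt

/-- The scalar part of the exponent contributes the factor `e^{-td}`, so that `e^{t(cT - d)}`
grows no faster than `e^{t(c‖T‖ - d)}`. -/
lemma norm_expSG_smul_sub_le (T : E →L[ℂ] E) {c d t : ℝ} (hc : 0 ≤ c) (ht : 0 ≤ t) :
    ‖expSG (c • T - d • 1) t‖ ≤ Real.exp (t * (c * ‖T‖ - d)) := by
  have h1 : t • (c • T - d • (1 : E →L[ℂ] E)) = (t * c) • T + (-(t * d)) • 1 := by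
    rw [smul_sub, smul_smul, smul_smul, neg_smul, sub_eq_add_neg]
  have h2 : NormedSpace.exp ((-(t * d)) • (1 : E →L[ℂ] E)) =
      Real.exp (-(t * d)) • (1 : E →L[ℂ] E) := by
    have := NormedSpace.algebraMap_exp_comm (𝕂 := ℝ) (𝔸 := E →L[ℂ] E) (-(t * d))
    rw [← Real.exp_eq_exp_ℝ, Algebra.algebraMap_eq_smul_one, Algebra.algebraMap_eq_smul_one] at this
    exact this.symm
  have h3 : Commute ((t * c) • T) ((-(t * d)) • (1 : E →L[ℂ] E)) :=
    ((Commute.one_right T).smul_left _).smul_right _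
  rw [expSG, h1, exp_add_of_commute' h3, h2, mul_smul_comm, mul_one, norm_smul, Real.norm_eq_abs,
    abs_of_pos (Real.exp_pos _)]
  calc Real.exp (-(t * d)) * ‖NormedSpace.exp ((t * c) • T)‖
      ≤ Real.exp (-(t * d)) * Real.exp (t * c * ‖T‖) := by
        gcongr
        refine (norm_exp_le _).trans ?_
        rw [norm_smul, Real.norm_eq_abs, abs_of_nonneg (by positivity)]
    _ = Real.exp (t * (c * ‖T‖ - d)) := by
        rw [← Real.exp_add]; congr 1; ring

/-- Duhamel's formula for commuting operators, as an estimate. -/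
lemma norm_expSG_sub_le {B C : E →L[ℂ] E} (h : Commute B C) {K : ℝ}
    (hB : ∀ s, 0 ≤ s → ‖expSG B s‖ ≤ Real.exp (s * K))
    (hC : ∀ s, 0 ≤ s → ‖expSG C s‖ ≤ Real.exp (s * K)) {t : ℝ} (ht : 0 ≤ t) (x : E) :
    ‖expSG B t x - expSG C t x‖ ≤ Real.exp (t * K) * ‖B x - C x‖ * t := by
  have hd : ∀ s ∈ Icc 0 t, HasDerivWithinAt (fun s => (expSG B s * expSG C (t - s)) x)
      ((expSG B s * expSG C (t - s)) (B x - C x)) (Icc 0 t) s := by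
    intro s _
    have h1 : HasDerivAt (fun s => expSG C (t - s)) (-(expSG C (t - s) * C)) s := by
      exact (hasDerivAt_expSG C (t - s)).comp_const_sub t s
    have h3 := hasDerivAt_apply ((hasDerivAt_expSG B s).mul h1) x
    have hc : B * expSG C (t - s) = expSG C (t - s) * B := (expSG_comm h.symm (t - s)).eq.symm
    have : expSG B s * B * expSG C (t - s) + expSG B s * -(expSG C (t - s) * C)
        = (expSG B s * expSG C (t - s)) * (B - C) := by
      rw [mul_assoc, hc, mul_neg, mul_sub, mul_assoc, mul_assoc, ← sub_eq_add_neg]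
    rw [this] at h3
    exact h3.hasDerivWithinAt
  have hb : ∀ s ∈ Ico 0 t, ‖(expSG B s * expSG C (t - s)) (B x - C x)‖ ≤
      Real.exp (t * K) * ‖B x - C x‖ := by
    intro s hs
    refine (ContinuousLinearMap.le_opNorm _ _).trans ?_
    gcongr
    refine (norm_mul_le _ _).trans ?_
    refine (mul_le_mul (hB s hs.1) (hC (t - s) (sub_nonneg.2 hs.2.le)) (norm_nonneg _)
      (Real.exp_pos _).le).trans_eq ?_
    rw [← Real.exp_add]; congr 1; ring
  have := norm_image_sub_le_of_norm_deriv_le_segment' hd hb t ⟨ht, le_rfl⟩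
  simpa [expSG_zero] using this

/-- First order Taylor estimate at `0`, with an arbitrary vector `z` in place of `B x`. -/
lemma norm_expSG_sub_self_sub_smul_le {B : E →L[ℂ] E} {x z : E} {t c : ℝ} (ht : 0 ≤ t)
    (hc : ∀ s ∈ Icc 0 t, ‖expSG B s (B x) - z‖ ≤ c) :
    ‖expSG B t x - x - t • z‖ ≤ c * t := by
  have hd : ∀ s ∈ Icc 0 t, HasDerivWithinAt (fun s => expSG B s x - s • z)
      (expSG B s (B x) - z) (Icc 0 t) s := by
    intro s _
    have h4 := (hasDerivAt_apply (hasDerivAt_expSG B s) x).sub ((hasDerivAt_id s).smul_const z)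
    rw [one_smul] at h4
    exact h4.hasDerivWithinAt
  have := norm_image_sub_le_of_norm_deriv_le_segment' hd
    (fun s hs => hc s (Ico_subset_Icc_self hs)) t ⟨ht, le_rfl⟩
  simpa [expSG_zero, sub_right_comm] using this

end BoundedExponential

/-! ### Limits of uniformly bounded commuting exponentials -/

section Limit

variable {E : Type*} [NormedAddCommGroup E] [NormedSpace ℂ E]

lemma tendsto_clm_apply_of_norm_le {F : Type*} [NormedAddCommGroup F] [NormedSpace ℂ F]
    {T : ℕ → E →L[ℂ] F} {C : ℝ} (hT : ∀ n, ‖T n‖ ≤ C)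
    {x : ℕ → E} {y : E} {z : F} (hx : Tendsto x atTop (𝓝 y))
    (hz : Tendsto (fun n => T n y) atTop (𝓝 z)) : Tendsto (fun n => T n (x n)) atTop (𝓝 z) := by
  have h : Tendsto (fun n => T n (x n - y)) atTop (𝓝 0) := by
    refine squeeze_zero_norm (a := fun n => C * ‖x n - y‖)
      (fun n => (T n).le_of_opNorm_le (hT n) _) ?_
    simpa using (tendsto_iff_norm_sub_tendsto_zero.1 hx).const_mul C
  simpa using h.add hz

lemma tendsto_clm_apply_self_of_dense {T : ℕ → E →L[ℂ] E} {C : ℝ} (hT : ∀ n, ‖T n‖ ≤ C)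
    {D : Set E} (hD : Dense D) (h : ∀ x ∈ D, Tendsto (fun n => T n x) atTop (𝓝 x)) (x : E) :
    Tendsto (fun n => T n x) atTop (𝓝 x) := by
  have hC : 0 ≤ C := (norm_nonneg _).trans (hT 0)
  rw [Metric.tendsto_atTop]
  intro ε hε
  obtain ⟨z, hz, hxz⟩ := Metric.dense_iff.1 hD x (ε / (2 * (C + 1))) (by positivity)
  obtain ⟨N, hN⟩ := Metric.tendsto_atTop.1 (h z hxz) (ε / 2) (by positivity)
  refine ⟨N, fun n hn => ?_⟩
  have h1 : ‖x - z‖ < ε / (2 * (C + 1)) := by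
    rwa [Metric.mem_ball, dist_comm, dist_eq_norm] at hz
  have h2 := hN n hn
  rw [dist_eq_norm] at h2 ⊢
  have h3 : T n x - x = T n (x - z) + (T n z - z) - (x - z) := by rw [map_sub]; abel
  have h4 : (C + 1) * ‖x - z‖ < ε / 2 := by
    rw [lt_div_iff₀ (by positivity)] at h1
    linarith
  calc ‖T n x - x‖ ≤ ‖T n (x - z)‖ + ‖T n z - z‖ + ‖x - z‖ := by
        rw [h3]
        exact (norm_sub_le _ _).trans (by gcongr; exact norm_add_le _ _)
    _ ≤ C * ‖x - z‖ + ‖T n z - z‖ + ‖x - z‖ := by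
        gcongr
        exact (T n).le_of_opNorm_le (hT n) _
    _ < ε := by linarith

variable [CompleteSpace E]

/-- If commuting generators `B n` converge strongly on a dense set and their exponentials are
uniformly bounded, then the exponentials are strongly Cauchy, uniformly on bounded time
intervals. -/
lemma uniformCauchySeqOn_expSG {B : ℕ → E →L[ℂ] E} (hcomm : ∀ m n, Commute (B m) (B n))
    {K : ℝ} (hK : 0 ≤ K) (hexp : ∀ n s, 0 ≤ s → ‖expSG (B n) s‖ ≤ Real.exp (s * K))
    {D : Set E} (hD : Dense D) (hB : ∀ x ∈ D, CauchySeq fun n => B n x) (x : E) (T : ℝ≥0) :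
    UniformCauchySeqOn (fun n (t : ℝ≥0) => expSG (B n) t x) atTop (Iic T) := by
  rw [Metric.uniformCauchySeqOn_iff]
  intro ε hε
  set M := Real.exp (T * K) with hM
  have hM0 : 0 < M := Real.exp_pos _
  obtain ⟨z, hz, hzD⟩ := Metric.dense_iff.1 hD x (ε / (4 * M)) (by positivity)
  have hxz : M * ‖x - z‖ < ε / 4 := by
    rw [Metric.mem_ball, dist_comm, dist_eq_norm, lt_div_iff₀ (by positivity)] at hz
    linarith
  obtain ⟨N, hN⟩ := Metric.cauchySeq_iff.1 (hB z hzD) (ε / (2 * M * (T + 1))) (by positivity)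
  refine ⟨N, fun m hm n hn t ht => ?_⟩
  have hle : Real.exp (t * K) ≤ M := by
    rw [hM]; gcongr; exact ht
  have hb : ∀ k, ‖expSG (B k) t (x - z)‖ ≤ M * ‖x - z‖ := fun k =>
    (expSG (B k) t).le_of_opNorm_le ((hexp k t t.2).trans hle) _
  have hmn := hN m hm n hn
  rw [dist_eq_norm, lt_div_iff₀ (by positivity)] at hmn
  have hz2 : ‖expSG (B m) t z - expSG (B n) t z‖ < ε / 2 := by
    refine (norm_expSG_sub_le (hcomm m n) (hexp m) (hexp n) t.2 z).trans_lt ?_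
    calc Real.exp (t * K) * ‖B m z - B n z‖ * (t : ℝ)
        ≤ M * ‖B m z - B n z‖ * (T + 1) := by
          gcongr
          exact (NNReal.coe_le_coe.2 ht).trans (by linarith)
      _ < ε / 2 := by linarith
  have key : expSG (B m) t x - expSG (B n) t x = expSG (B m) t (x - z) - expSG (B n) t (x - z)
      + (expSG (B m) t z - expSG (B n) t z) := by rw [map_sub, map_sub]; abel
  rw [dist_eq_norm, key]
  calc _ ≤ ‖expSG (B m) t (x - z)‖ + ‖expSG (B n) t (x - z)‖
        + ‖expSG (B m) t z - expSG (B n) t z‖ :=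
        (norm_add_le _ _).trans (by gcongr; exact norm_sub_le _ _)
    _ < ε := by linarith [hb m, hb n]

lemma exists_tendstoUniformlyOn_expSG {B : ℕ → E →L[ℂ] E} (hcomm : ∀ m n, Commute (B m) (B n))
    {K : ℝ} (hK : 0 ≤ K) (hexp : ∀ n s, 0 ≤ s → ‖expSG (B n) s‖ ≤ Real.exp (s * K))
    {D : Set E} (hD : Dense D) (hB : ∀ x ∈ D, CauchySeq fun n => B n x) :
    ∃ S : ℝ≥0 → E →L[ℂ] E, ∀ (x : E) (T : ℝ≥0),
      TendstoUniformlyOn (fun n (t : ℝ≥0) => expSG (B n) t x) (fun t => S t x) atTop (Iic T) := by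
  have hc := uniformCauchySeqOn_expSG hcomm hK hexp hD hB
  have hlim : ∀ (t : ℝ≥0) (x : E), ∃ y, Tendsto (fun n => expSG (B n) t x) atTop (𝓝 y) :=
    fun t x => cauchySeq_tendsto_of_complete ((hc x t).cauchySeq self_mem_Iic)
  choose f hf using hlim
  refine ⟨fun t => continuousLinearMapOfTendsto (fun n => expSG (B n) t)
    (f := f t) (tendsto_pi_nhds.2 (hf t)), fun x T => ?_⟩
  exact (hc x T).tendstoUniformlyOn_of_tendsto fun t _ => hf t x

variable {B : ℕ → E →L[ℂ] E} {K : ℝ} {S : ℝ≥0 → E →L[ℂ] E}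

lemma isC0Semigroup_of_tendstoUniformlyOn_expSG
    (hexp : ∀ n s, 0 ≤ s → ‖expSG (B n) s‖ ≤ Real.exp (s * K))
    (hS : ∀ (x : E) (T : ℝ≥0), TendstoUniformlyOn (fun n (t : ℝ≥0) => expSG (B n) t x)
      (fun t => S t x) atTop (Iic T)) : IsC0Semigroup S := by
  have hlim : ∀ t x, Tendsto (fun n => expSG (B n) (t : ℝ≥0) x) atTop (𝓝 (S t x)) :=
    fun t x => (hS x t).tendsto_at self_mem_Iic
  refine ⟨?_, fun s t => ?_, fun x => ?_⟩
  · ext x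
    refine tendsto_nhds_unique (hlim 0 x) ?_
    simp [expSG_zero]
  · ext x
    refine tendsto_nhds_unique (hlim (s + t) x) ?_
    have := tendsto_clm_apply_of_norm_le (fun n => hexp n s s.2) (hlim t x) (hlim s (S t x))
    simpa [expSG_add] using this
  · refine continuous_iff_continuousAt.2 fun t => ?_
    refine ContinuousOn.continuousAt (s := Iic (t + 1)) ?_
      (Iic_mem_nhds (lt_add_of_pos_right t one_pos))
    refine (hS x (t + 1)).continuousOn (Frequently.of_forall fun n => ?_)
    exact ((((ContinuousLinearMap.apply ℂ E x).continuous).comp (expSG_continuous (B n))).comp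
      NNReal.continuous_coe).continuousOn

/-- The limit semigroup is differentiable at `0` along every vector on which the generators of the
approximating semigroups converge. -/
lemma tendsto_difference_quotient_of_tendsto (hK : 0 ≤ K)
    (hexp : ∀ n s, 0 ≤ s → ‖expSG (B n) s‖ ≤ Real.exp (s * K))
    (hS : ∀ (x : E) (T : ℝ≥0), TendstoUniformlyOn (fun n (t : ℝ≥0) => expSG (B n) t x)
      (fun t => S t x) atTop (Iic T)) {x y : E} (hxy : Tendsto (fun n => B n x) atTop (𝓝 y)) :
    Tendsto (fun h : ℝ≥0 => (((h : ℝ) : ℂ))⁻¹ • (S h x - x)) (𝓝[>] 0) (𝓝 y) := by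
  have hSG := isC0Semigroup_of_tendstoUniformlyOn_expSG hexp hS
  rw [Metric.tendsto_nhds]
  intro ε hε
  have h0 : Tendsto (fun t => S t y) (𝓝 0) (𝓝 y) := by
    have := (hSG.continuous y).tendsto 0
    rwa [hSG.map_zero] at this
  obtain ⟨δ, hδ, hδ'⟩ := Metric.tendsto_nhds_nhds.1 h0 (ε / 4) (by positivity)
  have hev : ∀ᶠ h : ℝ≥0 in 𝓝[>] 0, dist h 0 < δ :=
    mem_nhdsWithin_of_mem_nhds (Metric.ball_mem_nhds 0 hδ)
  filter_upwards [hev, self_mem_nhdsWithin] with h hh hh0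
  have hpos : (0 : ℝ) < h := hh0
  -- On `[0, h]` the orbit of `y` stays close to `y`, and the approximating orbits stay close to it.
  have hb : ‖S h x - x - (h : ℝ) • y‖ ≤ (3 * (ε / 4)) * h := by
    have hl : Tendsto (fun n => ‖expSG (B n) h x - x - (h : ℝ) • y‖) atTop
        (𝓝 ‖S h x - x - (h : ℝ) • y‖) :=
      ((((hS x h).tendsto_at self_mem_Iic).sub_const x).sub_const _).norm
    have hu := Metric.tendstoUniformlyOn_iff.1 (hS y h) (ε / 4) (by positivity)
    have hBx : ∀ᶠ n in atTop, Real.exp (h * K) * ‖B n x - y‖ < ε / 4 := by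
      have := (tendsto_iff_norm_sub_tendsto_zero.1 hxy).const_mul (Real.exp (h * K))
      rw [mul_zero] at this
      exact this.eventually (gt_mem_nhds (by positivity))
    refine le_of_tendsto hl ?_
    filter_upwards [hu, hBx] with n hn1 hn2
    refine norm_expSG_sub_self_sub_smul_le hpos.le fun s hs => ?_
    lift s to ℝ≥0 using hs.1
    have hsh : s ≤ h := hs.2
    have e1 : ‖expSG (B n) s (B n x - y)‖ ≤ Real.exp (h * K) * ‖B n x - y‖ := by
      refine (expSG (B n) s).le_of_opNorm_le ((hexp n s s.2).trans ?_) _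
      gcongr
    have e2 := hn1 s hsh
    have e3 : dist (S s y) y < ε / 4 := by
      refine hδ' (lt_of_le_of_lt ?_ hh)
      rw [NNReal.dist_eq, NNReal.dist_eq]
      simpa using hsh
    rw [dist_comm, dist_eq_norm] at e2
    rw [dist_eq_norm] at e3
    have e4 : expSG (B n) s (B n x) - y = expSG (B n) s (B n x - y)
        + (expSG (B n) s y - S s y) + (S s y - y) := by rw [map_sub]; abel
    rw [e4]
    refine (norm_add₃_le).trans ?_
    linarith
  have e : (((h : ℝ) : ℂ))⁻¹ • (S h x - x) - y =
      (((h : ℝ) : ℂ))⁻¹ • (S h x - x - (h : ℝ) • y) := by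
    rw [smul_sub _ (S h x - x), ← Complex.coe_smul (h : ℝ) y, smul_smul,
      inv_mul_cancel₀ (by exact_mod_cast hpos.ne'), one_smul]
  rw [dist_eq_norm, e, norm_smul, norm_inv, Complex.norm_real, Real.norm_eq_abs,
    abs_of_pos hpos, inv_mul_lt_iff₀ hpos]
  nlinarith

end Limit

/-! ### Generation of semigroups by quasi-dissipative operators -/

section Generation

variable {E : Type*} [NormedAddCommGroup E] [NormedSpace ℂ E]

/-- `R` is a right inverse of `r - A`, where `A` is given by its graph `G`. -/
def IsResolvent (G : Submodule ℂ (E × E)) (r : ℝ) (R : E →L[ℂ] E) : Prop :=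
  ∀ y, (R y, r • R y - y) ∈ G

/-- The operator with graph `G` is quasi-dissipative: `A - ω` is dissipative. -/
def IsQuasiDissipative (G : Submodule ℂ (E × E)) (ω : ℝ) : Prop :=
  ∀ r : ℝ, ω < r → ∀ x ∈ G, (r - ω) * ‖x.1‖ ≤ ‖r • x.1 - x.2‖

variable {G : Submodule ℂ (E × E)} {ω : ℝ}

lemma IsQuasiDissipative.eq_of_mem (hG : IsQuasiDissipative G ω) {r : ℝ} (hr : ω < r) {x x' y : E}
    (hx : (x, r • x - y) ∈ G) (hx' : (x', r • x' - y) ∈ G) : x = x' := by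
  have h := hG r hr _ (G.sub_mem hx hx')
  have h0 : r • (x - x') - (r • x - y - (r • x' - y)) = 0 := by rw [smul_sub]; abel
  simp only [Prod.mk_sub_mk, h0, norm_zero] at h
  have : ‖x - x'‖ ≤ 0 := by
    by_contra! hc
    nlinarith [sub_pos.2 hr]
  exact sub_eq_zero.1 (norm_le_zero_iff.1 this)

lemma IsQuasiDissipative.exists_isResolvent (hG : IsQuasiDissipative G ω) {r : ℝ} (hr : ω < r)
    (hs : ∀ y, ∃ x, (x, r • x - y) ∈ G) : ∃ R : E →L[ℂ] E, IsResolvent G r R := by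
  choose f hf using hs
  let R : E →ₗ[ℂ] E :=
    { toFun := f
      map_add' := fun y z => by
        refine hG.eq_of_mem hr (hf _) ?_
        convert G.add_mem (hf y) (hf z) using 1
        ext
        · rfl
        · simp only [Prod.snd_add, smul_add]; abel
      map_smul' := fun c y => by
        refine hG.eq_of_mem hr (hf _) ?_
        convert G.smul_mem c (hf y) using 1
        ext
        · rfl
        · simp only [Prod.smul_snd, smul_sub, RingHom.id_apply, smul_comm r c] }
  refine ⟨R.mkContinuous (r - ω)⁻¹ fun y => ?_, hf⟩
  have h := hG r hr _ (hf y)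
  simp only [sub_sub_cancel] at h
  rwa [inv_mul_eq_div, le_div_iff₀ (sub_pos.2 hr), mul_comm]

lemma IsResolvent.norm_le {r : ℝ} {R : E →L[ℂ] E} (hR : IsResolvent G r R)
    (hG : IsQuasiDissipative G ω) (hr : ω < r) : ‖R‖ ≤ (r - ω)⁻¹ := by
  refine R.opNorm_le_bound (inv_nonneg.2 (sub_nonneg.2 hr.le)) fun y => ?_
  have h := hG r hr _ (hR y)
  simp only [sub_sub_cancel] at h
  rwa [inv_mul_eq_div, le_div_iff₀ (sub_pos.2 hr), mul_comm]

lemma IsResolvent.apply_eq {r : ℝ} {R : E →L[ℂ] E} (hR : IsResolvent G r R)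
    (hG : IsQuasiDissipative G ω) (hr : ω < r) {x z : E} (hx : (x, z) ∈ G) :
    R (r • x - z) = x := by
  refine hG.eq_of_mem hr (hR _) ?_
  simpa using hx

/-- The resolvent identity. -/
lemma IsResolvent.sub_apply {r s : ℝ} {R Q : E →L[ℂ] E} (hR : IsResolvent G r R)
    (hQ : IsResolvent G s Q) (hG : IsQuasiDissipative G ω) (hr : ω < r) (y : E) :
    R y - Q y = (s - r) • R (Q y) := by
  have h := hR.apply_eq hG hr (hQ y)
  have e : r • Q y - (s • Q y - y) = y - (s - r) • Q y := by rw [sub_smul]; abel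
  rw [e, map_sub, ← Complex.coe_smul, map_smul, Complex.coe_smul] at h
  exact sub_eq_iff_eq_add.2 (sub_eq_iff_eq_add'.1 h)

lemma IsResolvent.commute {r s : ℝ} {R Q : E →L[ℂ] E} (hR : IsResolvent G r R)
    (hQ : IsResolvent G s Q) (hG : IsQuasiDissipative G ω) (hr : ω < r) (hs : ω < s) :
    Commute R Q := by
  ext y
  change R (Q y) = Q (R y)
  rcases eq_or_ne r s with rfl | hne
  · have : ∀ z, R z = Q z := fun z => hG.eq_of_mem hr (hR z) (hQ z)
    rw [this (Q y), this y]
  · have h1 := hR.sub_apply hQ hG hr y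
    have h2 := hQ.sub_apply hR hG hs y
    have h3 : (s - r) • R (Q y) = (s - r) • Q (R y) := by
      rw [← h1, ← neg_sub (Q y), h2, ← neg_smul, neg_sub]
    exact smul_right_injective E (sub_ne_zero.2 hne.symm) h3

/-- A semigroup of growth bound `ω` has no orbit with initial velocity `r x`, `r > ω`, `x ≠ 0`. -/
lemma eq_zero_of_tendsto_difference_quotient {S : ℝ≥0 → E →L[ℂ] E}
    (hS : ∀ t : ℝ≥0, ‖S t‖ ≤ Real.exp (ω * t)) {r : ℝ} (hr : ω < r) {x : E}
    (hx : Tendsto (fun h : ℝ≥0 => (((h : ℝ) : ℂ))⁻¹ • (S h x - x)) (𝓝[>] 0) (𝓝 (r • x))) :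
    x = 0 := by
  have hcoe : Tendsto (fun h : ℝ≥0 => (h : ℝ)) (𝓝[>] 0) (𝓝[>] 0) := by
    refine tendsto_nhdsWithin_iff.2 ⟨?_, ?_⟩
    · exact (NNReal.continuous_coe.tendsto' 0 0 rfl).mono_left nhdsWithin_le_nhds
    · filter_upwards [self_mem_nhdsWithin] with h hh using NNReal.coe_pos.2 hh
  have hexp : Tendsto (fun h : ℝ≥0 => (h : ℝ)⁻¹ * (Real.exp (ω * h) - 1)) (𝓝[>] 0) (𝓝 ω) := by
    have h1 : HasDerivAt (fun t : ℝ => Real.exp (ω * t)) ω 0 := by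
      simpa using ((hasDerivAt_id (0 : ℝ)).const_mul ω).exp
    have h2 := h1.tendsto_slope_zero_right.comp hcoe
    simpa [Function.comp_def] using h2
  have hlim : Tendsto (fun h : ℝ≥0 => r * ‖x‖ -
      ‖(((h : ℝ) : ℂ))⁻¹ • (S h x - x) - r • x‖) (𝓝[>] 0) (𝓝 (r * ‖x‖)) := by
    simpa using (tendsto_iff_norm_sub_tendsto_zero.1 hx).const_sub (r * ‖x‖)
  have hle : r * ‖x‖ ≤ ω * ‖x‖ := by
    refine le_of_tendsto_of_tendsto hlim (hexp.mul_const ‖x‖) ?_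
    filter_upwards [self_mem_nhdsWithin] with h hh
    have hh' : (0 : ℝ) < h := NNReal.coe_pos.2 hh
    have e : S h x = (1 + h * r) • x
        + (h : ℝ) • ((((h : ℝ) : ℂ))⁻¹ • (S h x - x) - r • x) := by
      rw [smul_sub, ← Complex.coe_smul (h : ℝ) (_⁻¹ • _), smul_smul,
        mul_inv_cancel₀ (by exact_mod_cast hh'.ne'), one_smul, add_smul, one_smul, mul_smul]
      abel
    set d := (((h : ℝ) : ℂ))⁻¹ • (S h x - x) - r • x
    have h1 : (1 + h * r) * ‖x‖ ≤ Real.exp (ω * h) * ‖x‖ + h * ‖d‖ := by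
      have h2 : (1 + h * r) • x = S h x - (h : ℝ) • d := by rw [e]; abel
      calc (1 + h * r) * ‖x‖ ≤ ‖(1 + h * r) • x‖ := by
            rw [norm_smul]; gcongr; exact le_abs_self _
        _ ≤ ‖S h x‖ + ‖(h : ℝ) • d‖ := by rw [h2]; exact norm_sub_le _ _
        _ ≤ _ := by
            rw [norm_smul, Real.norm_eq_abs, abs_of_pos hh']
            gcongr
            exact (S h).le_of_opNorm_le (hS h) x
    change r * ‖x‖ - ‖d‖ ≤ (h : ℝ)⁻¹ * (Real.exp (ω * h) - 1) * ‖x‖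
    rw [mul_assoc, ← div_eq_inv_mul, le_div_iff₀ hh']
    linarith
  refine norm_le_zero_iff.1 ?_
  by_contra! hc
  nlinarith

variable [CompleteSpace E]

/-- The Hille–Yosida theorem, by Yosida approximation: `A` is approximated by the bounded operators
`n A (n - A)⁻¹ = n² (n - A)⁻¹ - n`. The operator `A` is given by its graph `G`. -/
theorem exists_c0Semigroup_of_isQuasiDissipative (hω : 0 ≤ ω) (hG : IsQuasiDissipative G ω)
    (hD : Dense (Prod.fst '' (G : Set (E × E))))
    (hs : ∀ᶠ n : ℕ in atTop, ∀ y, ∃ x, (x, (n : ℝ) • x - y) ∈ G) :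
    ∃ S : ℝ≥0 → E →L[ℂ] E, IsC0Semigroup S ∧
      (∀ x y, (x, y) ∈ G ↔
        Tendsto (fun h : ℝ≥0 => (((h : ℝ) : ℂ))⁻¹ • (S h x - x)) (𝓝[>] 0) (𝓝 y)) ∧
      ∀ τ : ℝ≥0, ‖S τ‖ ≤ Real.exp (ω * τ) := by
  obtain ⟨N, hN⟩ := eventually_atTop.1
    (hs.and (tendsto_natCast_atTop_atTop.eventually_gt_atTop (2 * ω)))
  -- With `r > 2 ω` the growth bound `w = r ω / (r - ω)` of the Yosida approximation at `r` is at
  -- most `2 ω`, which makes the approximations uniformly bounded on bounded time intervals.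
  let r : ℕ → ℝ := fun n => ((n + N : ℕ) : ℝ)
  have hr2 : ∀ n, 2 * ω < r n := fun n => (hN (n + N) (Nat.le_add_left _ _)).2
  have hr : ∀ n, ω < r n := fun n => by linarith [hr2 n]
  have hr0 : ∀ n, 0 < r n := fun n => hω.trans_lt (hr n)
  have hrlim : Tendsto r atTop atTop :=
    tendsto_natCast_atTop_atTop.comp (tendsto_add_atTop_nat N)
  have hres : ∀ n, ∃ R : E →L[ℂ] E, IsResolvent G (r n) R := fun n =>
    hG.exists_isResolvent (hr n) (hN (n + N) (Nat.le_add_left _ _)).1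
  choose R hR using hres
  let B : ℕ → E →L[ℂ] E := fun n => (r n ^ 2) • R n - r n • 1
  let w : ℕ → ℝ := fun n => r n * ω / (r n - ω)
  have hsub : ∀ n, 0 < r n - ω := fun n => sub_pos.2 (hr n)
  have hexp : ∀ n s, 0 ≤ s → ‖expSG (B n) s‖ ≤ Real.exp (s * w n) := by
    intro n s hs
    refine (norm_expSG_smul_sub_le (R n) (sq_nonneg (r n)) hs).trans ?_
    gcongr
    have := mul_le_mul_of_nonneg_left ((hR n).norm_le hG (hr n)) (sq_nonneg (r n))
    have e : r n ^ 2 * (r n - ω)⁻¹ - r n = w n := by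
      simp only [w]
      field_simp [(hsub n).ne']
      ring
    linarith
  have hw : ∀ n, w n ≤ 2 * ω := fun n => by
    simp only [w]
    rw [div_le_iff₀ (hsub n)]
    nlinarith [hr2 n]
  have hwlim : Tendsto w atTop (𝓝 ω) := by
    have h1 : Tendsto (fun n => ω + ω ^ 2 * (r n - ω)⁻¹) atTop (𝓝 (ω + ω ^ 2 * 0)) :=
      ((tendsto_inv_atTop_zero.comp (tendsto_atTop_add_const_right _ (-ω) hrlim)).const_mul
        _).const_add _
    rw [mul_zero, add_zero] at h1
    refine h1.congr fun n => ?_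
    simp only [w]
    field_simp [(hsub n).ne']
    ring
  have hexp2 : ∀ n s, 0 ≤ s → ‖expSG (B n) s‖ ≤ Real.exp (s * (2 * ω)) := fun n s hs =>
    (hexp n s hs).trans (by gcongr; exact hw n)
  have hcomm : ∀ m n, Commute (B m) (B n) := by
    intro m n
    have hc : Commute (R m) (R n) := (hR m).commute (hR n) hG (hr m) (hr n)
    have h1 : ∀ (c : ℝ) (T : E →L[ℂ] E), Commute (c • (1 : E →L[ℂ] E)) T := fun c T =>
      (Commute.one_left T).smul_left c
    exact (((hc.smul_left _).smul_right _).sub_left (h1 _ _)).sub_right (h1 _ _).symm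
  -- `r (r - A)⁻¹` tends strongly to the identity: first on the domain, then by density.
  have hbd : ∀ n, ‖r n • R n‖ ≤ 2 := fun n => by
    rw [norm_smul, Real.norm_eq_abs, abs_of_pos (hr0 n)]
    calc r n * ‖R n‖ ≤ r n * (r n - ω)⁻¹ := by
          have := hr0 n
          gcongr
          exact (hR n).norm_le hG (hr n)
      _ ≤ 2 := by
          rw [← div_eq_mul_inv, div_le_iff₀ (hsub n)]
          linarith [hr2 n]
  have hRA : ∀ n, ∀ x ∈ G, r n • R n x.1 - x.1 = R n x.2 := fun n x hx => by
    have h := (hR n).apply_eq hG (hr n) hx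
    rw [map_sub, ← Complex.coe_smul, map_smul, Complex.coe_smul] at h
    nth_rewrite 2 [← h]
    abel
  have hRlim : ∀ x, Tendsto (fun n => (r n • R n) x) atTop (𝓝 x) := by
    refine tendsto_clm_apply_self_of_dense hbd hD ?_
    rintro _ ⟨x, hx, rfl⟩
    rw [tendsto_iff_norm_sub_tendsto_zero]
    refine squeeze_zero (g := fun n => 2 * ‖x.2‖ * (r n)⁻¹) (fun _ => norm_nonneg _)
      (fun n => ?_) ?_
    · have e : (r n • R n) x.1 - x.1 = (r n)⁻¹ • (r n • R n) x.2 := by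
        rw [smul_apply, hRA n x hx, smul_apply,
          smul_smul, inv_mul_cancel₀ (hr0 n).ne', one_smul]
      rw [e, norm_smul, norm_inv, Real.norm_eq_abs, abs_of_pos (hr0 n), mul_comm]
      have := (r n • R n).le_of_opNorm_le (hbd n) x.2
      have h0 := hr0 n
      gcongr
    · simpa using (tendsto_inv_atTop_zero.comp hrlim).const_mul (2 * ‖x.2‖)
  have hBlim : ∀ x ∈ G, Tendsto (fun n => B n x.1) atTop (𝓝 x.2) := by
    intro x hx
    refine (hRlim x.2).congr fun n => ?_
    change r n • R n x.2 = r n ^ 2 • R n x.1 - r n • x.1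
    rw [← hRA n x hx, smul_sub, smul_smul, sq]
  obtain ⟨S, hS⟩ := exists_tendstoUniformlyOn_expSG hcomm (by positivity) hexp2 hD
    (by rintro _ ⟨x, hx, rfl⟩; exact (hBlim x hx).cauchySeq)
  have hbound : ∀ τ : ℝ≥0, ‖S τ‖ ≤ Real.exp (ω * τ) := by
    intro τ
    refine (S τ).opNorm_le_bound (Real.exp_pos _).le fun x => ?_
    refine le_of_tendsto_of_tendsto ((hS x τ).tendsto_at self_mem_Iic).norm
      (((Real.continuous_exp.tendsto _).comp (hwlim.mul_const (τ : ℝ))).mul_const ‖x‖)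
      (Eventually.of_forall fun n => ?_)
    refine (expSG (B n) τ).le_of_opNorm_le ((hexp n τ τ.2).trans_eq ?_) x
    rw [mul_comm]; rfl
  have hgen : ∀ x y, (x, y) ∈ G →
      Tendsto (fun h : ℝ≥0 => (((h : ℝ) : ℂ))⁻¹ • (S h x - x)) (𝓝[>] 0) (𝓝 y) := fun x y hxy =>
    tendsto_difference_quotient_of_tendsto (by positivity) hexp2 hS (hBlim _ hxy)
  refine ⟨S, isC0Semigroup_of_tendstoUniformlyOn_expSG hexp2 hS,
    fun x y => ⟨hgen x y, fun hxy => ?_⟩, hbound⟩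
  -- The generator of `S` extends `A`, and `r - A` is already onto, so they agree.
  have hz := hR 0 (r 0 • x - y)
  set z := R 0 (r 0 • x - y)
  have hd := hxy.sub (hgen _ _ hz)
  have hxz : x - z = 0 := by
    refine eq_zero_of_tendsto_difference_quotient hbound (hr 0) (x := x - z) ?_
    convert hd using 2
    · rw [← smul_sub, map_sub]; congr 1; abel
    · rw [smul_sub]; abel
  rw [← sub_eq_zero.1 hxz] at hz
  simpa using hz

end Generation

/-! ### Closure and bounded perturbation of quasi-dissipative operators -/

section ClosurePerturbation

variable {E : Type*} [NormedAddCommGroup E] [NormedSpace ℂ E] {G : Submodule ℂ (E × E)} {ω : ℝ}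

lemma IsQuasiDissipative.topologicalClosure (hG : IsQuasiDissipative G ω) :
    IsQuasiDissipative G.topologicalClosure ω := by
  intro r hr x hx
  refine closure_minimal (s := (G : Set (E × E)))
    (t := {x | (r - ω) * ‖x.1‖ ≤ ‖r • x.1 - x.2‖}) (hG r hr) ?_ hx
  exact isClosed_le (by fun_prop) (by fun_prop)

/-- A densely defined quasi-dissipative operator is closable: if `(0, y)` is in the closure of the
graph and `x` is in the domain, then letting `r → ∞` in the dissipativity inequality for
`(x, A x + r y)` gives `‖x‖ ≤ ‖x - y‖`, and `x` may tend to `y`. -/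
lemma IsQuasiDissipative.eq_zero_of_mem_topologicalClosure (hG : IsQuasiDissipative G ω)
    (hD : Dense (Prod.fst '' (G : Set (E × E)))) {y : E}
    (hy : ((0 : E), y) ∈ G.topologicalClosure) : y = 0 := by
  have key : ∀ x ∈ Prod.fst '' (G : Set (E × E)), ‖x‖ ≤ ‖x - y‖ := by
    rintro _ ⟨⟨x, z⟩, hx, rfl⟩
    have hr : ∀ᶠ r : ℝ in atTop, (1 - ω * r⁻¹) * ‖x‖ ≤ ‖x - y - r⁻¹ • z‖ := by
      filter_upwards [eventually_gt_atTop ω, eventually_gt_atTop 0] with r h1 h2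
      have hmem : (x, z + r • y) ∈ G.topologicalClosure := by
        have := G.topologicalClosure.add_mem (G.le_topologicalClosure hx)
          (G.topologicalClosure.smul_mem (r : ℂ) hy)
        simpa using this
      have h3 := hG.topologicalClosure r h1 _ hmem
      have e : r • x - (z + r • y) = r • (x - y - r⁻¹ • z) := by
        rw [smul_sub, smul_sub, smul_smul, mul_inv_cancel₀ h2.ne', one_smul]; abel
      rw [e, norm_smul, Real.norm_eq_abs, abs_of_pos h2] at h3
      refine le_of_mul_le_mul_left (le_trans (le_of_eq ?_) h3) h2
      field_simp
    have hl : Tendsto (fun r : ℝ => (1 - ω * r⁻¹) * ‖x‖) atTop (𝓝 ((1 - ω * 0) * ‖x‖)) :=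
      ((tendsto_inv_atTop_zero.const_mul ω).const_sub 1).mul_const _
    have hl2 : Tendsto (fun r : ℝ => ‖x - y - r⁻¹ • z‖) atTop (𝓝 ‖x - y - (0 : ℝ) • z‖) :=
      ((tendsto_inv_atTop_zero.smul_const z).const_sub _).norm
    simpa using le_of_tendsto_of_tendsto hl hl2 hr
  have h : ‖y‖ ≤ ‖y - y‖ :=
    closure_minimal (t := {x | ‖x‖ ≤ ‖x - y‖}) key
      (isClosed_le continuous_norm (by fun_prop)) (hD y)
  simpa using h

lemma IsQuasiDissipative.exists_of_dense_range [CompleteSpace E] (hG : IsQuasiDissipative G ω)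
    (hGc : IsClosed (G : Set (E × E))) {r : ℝ} (hr : ω < r)
    (hd : Dense ((fun x : E × E => (r : ℂ) • x.1 - x.2) '' (G : Set (E × E)))) (y : E) :
    ∃ x, (x, r • x - y) ∈ G := by
  obtain ⟨g, hg, hgy⟩ := mem_closure_iff_seq_limit.1 (hd y)
  choose x hxG hx using hg
  have hx' : ∀ k, r • (x k).1 - (x k).2 = g k := hx
  have hc : CauchySeq fun k => (x k).1 := by
    rw [Metric.cauchySeq_iff']
    intro ε hε
    obtain ⟨N, hN⟩ := Metric.cauchySeq_iff'.1 hgy.cauchySeq ((r - ω) * ε)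
      (mul_pos (sub_pos.2 hr) hε)
    refine ⟨N, fun k hk => ?_⟩
    have h1 := hG r hr _ (G.sub_mem (hxG k) (hxG N))
    have h2 := hN k hk
    have e : r • (x k - x N).1 - (x k - x N).2 = g k - g N := by
      rw [← hx', ← hx', Prod.fst_sub, Prod.snd_sub, smul_sub]; abel
    rw [e, ← dist_eq_norm, Prod.fst_sub, ← dist_eq_norm] at h1
    exact lt_of_mul_lt_mul_left (h1.trans_lt h2) (sub_pos.2 hr).le
  obtain ⟨z, hz⟩ := cauchySeq_tendsto_of_complete hc
  refine ⟨z, hGc.mem_of_tendsto (hz.prodMk_nhds ((hz.const_smul r).sub hgy))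
    (Eventually.of_forall fun k => ?_)⟩
  have e : r • (x k).1 - g k = (x k).2 := by rw [← hx']; abel
  rw [e]
  exact hxG k

variable {G' : Submodule ℂ (E × E)} {P : E →L[ℂ] E} {c : ℝ}

lemma IsQuasiDissipative.of_perturbation (hG : IsQuasiDissipative G ω) (hP : ‖P‖ ≤ c)
    (hG' : ∀ x z, (x, z) ∈ G' ↔ (x, z - P x) ∈ G) : IsQuasiDissipative G' (ω + c) := by
  rintro r hr ⟨x, z⟩ hx
  have hc : 0 ≤ c := (norm_nonneg _).trans hP
  have h1 := hG r (by linarith) _ ((hG' x z).1 hx)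
  have h2 : ‖r • x - (z - P x)‖ ≤ ‖r • x - z‖ + c * ‖x‖ := by
    rw [← sub_add]
    exact (norm_add_le _ _).trans (by gcongr; exact P.le_of_opNorm_le hP x)
  simp only at h1 ⊢
  linarith

/-- Solving `(r - A - P) x = y` through `(1 - P (r - A)⁻¹) z = y`, `x = (r - A)⁻¹ z`. -/
lemma IsQuasiDissipative.exists_of_perturbation [CompleteSpace E] (hG : IsQuasiDissipative G ω)
    (hP : ‖P‖ ≤ c) (hG' : ∀ x z, (x, z) ∈ G' ↔ (x, z - P x) ∈ G) {r : ℝ} (hr : ω + c < r)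
    (hs : ∀ y, ∃ x, (x, r • x - y) ∈ G) (y : E) : ∃ x, (x, r • x - y) ∈ G' := by
  have hc : 0 ≤ c := (norm_nonneg _).trans hP
  have hr' : ω < r := by linarith
  obtain ⟨R, hR⟩ := hG.exists_isResolvent hr' hs
  have hlt : ‖P * R‖ < 1 := by
    refine (norm_mul_le _ _).trans_lt ?_
    calc ‖P‖ * ‖R‖ ≤ c * (r - ω)⁻¹ := by
          have := hR.norm_le hG hr'
          gcongr
      _ < 1 := by
          rw [← div_eq_mul_inv, div_lt_one (sub_pos.2 hr')]
          linarith
  obtain ⟨T, hT⟩ := (isUnit_one_sub_of_norm_lt_one hlt).exists_right_inv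
  have hz : T y - P (R (T y)) = y := by
    have := DFunLike.congr_fun hT y
    simpa using this
  refine ⟨R (T y), (hG' _ _).2 ?_⟩
  have e : r • R (T y) - y - P (R (T y)) = r • R (T y) - T y := by
    nth_rewrite 2 [← hz]
    abel
  rw [e]
  exact hR (T y)

end ClosurePerturbation

/-- In a Hilbert space, quasi-dissipativity follows from the bound `Re ⟪A x, x⟫ ≤ ω ‖x‖²`. -/
lemma IsQuasiDissipative.of_re_inner_le {E : Type*} [NormedAddCommGroup E] [InnerProductSpace ℂ E]
    {G : Submodule ℂ (E × E)} {ω : ℝ}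
    (h : ∀ x ∈ G, RCLike.re (inner ℂ x.2 x.1) ≤ ω * ‖x.1‖ ^ 2) : IsQuasiDissipative G ω := by
  intro r hr x hx
  have h1 : RCLike.re (inner ℂ (r • x.1 - x.2) x.1) =
      r * ‖x.1‖ ^ 2 - RCLike.re (inner ℂ x.2 x.1) := by
    rw [inner_sub_left, map_sub, ← Complex.coe_smul, inner_smul_left, Complex.conj_ofReal,
      inner_self_eq_norm_sq_to_K]
    congr 1
    change ((r : ℂ) * (‖x.1‖ : ℂ) ^ 2).re = _
    rw [← Complex.ofReal_pow, ← Complex.ofReal_mul, Complex.ofReal_re]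
  have h2 : RCLike.re (inner ℂ (r • x.1 - x.2) x.1) ≤ ‖r • x.1 - x.2‖ * ‖x.1‖ :=
    re_inner_le_norm _ _
  have h3 := h x hx
  rcases (norm_nonneg x.1).eq_or_lt with h0 | h0
  · rw [← h0, mul_zero]
    exact norm_nonneg _
  · refine le_of_mul_le_mul_right ?_ h0
    nlinarith

/-! ### Dissipativity of the free operator -/

section Dissipativity

lemma L2I.re_inner_eq (f g : L2I) :
    RCLike.re (inner ℂ f g) = ∫ ρ, inner ℝ (f ρ) (g ρ) ∂μI := by
  rw [L2.inner_def, ← integral_re (L2.integrable_inner f g)]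
  exact integral_congr_ae (Eventually.of_forall fun ρ => (real_inner_eq_re_inner ℂ _ _).symm)

lemma L2I.integrable_real_inner (f g : L2I) : Integrable (fun ρ => inner ℝ (f ρ) (g ρ)) μI := by
  refine (L2.integrable_inner (𝕜 := ℂ) f g).re.congr (Eventually.of_forall fun ρ => ?_)
  exact (real_inner_eq_re_inner ℂ _ _).symm

lemma IsC1.hasDerivAt {v : ℝ → ℂ} (hv : IsC1 v) {ρ : ℝ} (hρ : ρ ∈ Ioo (0 : ℝ) 1) :
    HasDerivAt v (dI v ρ) ρ :=
  (hv.differentiableWithinAt hρ).hasDerivWithinAt.hasDerivAt (Icc_mem_nhds hρ.1 hρ.2)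

/-- The primitive of the energy density `Re ((L̃₀ v - v / 2) · v̄)`. -/
noncomputable def energyFlux (v₁ v₂ : ℝ → ℂ) (ρ : ℝ) : ℝ :=
  -ρ / 2 * (‖v₁ ρ‖ ^ 2 + ‖v₂ ρ‖ ^ 2) + inner ℝ (v₁ ρ) (v₂ ρ)

lemma hasDerivAt_energyFlux {v₁ v₂ : ℝ → ℂ} (h₁ : IsC1 v₁) (h₂ : IsC1 v₂) {ρ : ℝ}
    (hρ : ρ ∈ Ioo (0 : ℝ) 1) :
    HasDerivAt (energyFlux v₁ v₂)
      (inner ℝ (-(ρ : ℂ) * dI v₁ ρ + dI v₂ ρ - 1 / 2 * v₁ ρ) (v₁ ρ) +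
        inner ℝ (dI v₁ ρ - (ρ : ℂ) * dI v₂ ρ - 1 / 2 * v₂ ρ) (v₂ ρ)) ρ := by
  have d₁ := h₁.hasDerivAt hρ
  have d₂ := h₂.hasDerivAt hρ
  have h := (((hasDerivAt_id ρ).neg.div_const 2).mul (d₁.norm_sq.add d₂.norm_sq)).add
    (d₁.inner ℝ d₂)
  refine h.congr_deriv ?_
  simp only [Complex.inner, Complex.sq_norm, Complex.normSq_apply, Pi.add_apply, Pi.neg_apply, id]
  simp
  ring

lemma energyFlux_one_sub_zero_nonpos {v₁ v₂ : ℝ → ℂ} (h0 : v₁ 0 = 0) :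
    energyFlux v₁ v₂ 1 - energyFlux v₁ v₂ 0 ≤ 0 := by
  have h := norm_sub_sq_real (v₁ 1) (v₂ 1)
  simp only [energyFlux, h0, neg_zero, zero_div, zero_mul, inner_zero_left, add_zero, sub_zero]
  nlinarith [sq_nonneg ‖v₁ 1 - v₂ 1‖]

/-- The energy estimate `Re ⟪L̃₀ u, u⟫ ≤ ‖u‖² / 2`. The boundary term at `ρ = 1` is
`-|u₁(1) - u₂(1)|² / 2`, and the one at `ρ = 0` vanishes since `u₁(0) = 0`. -/
lemma re_inner_le_of_mem_preGraph {x : H × H} (hx : x ∈ preGraph) :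
    RCLike.re (inner ℂ x.2 x.1) ≤ 1 / 2 * ‖x.1‖ ^ 2 := by
  obtain ⟨v₁, v₂, h₁, h₂, h0, a1, a2, b1, b2⟩ := hx
  set g : H := x.2 - (1 / 2 : ℂ) • x.1 with hg
  have hre : RCLike.re (inner ℂ g x.1) = RCLike.re (inner ℂ x.2 x.1) - 1 / 2 * ‖x.1‖ ^ 2 := by
    rw [hg, inner_sub_left, map_sub, inner_smul_left, inner_self_eq_norm_sq_to_K]
    congr 1
    have e : (starRingEnd ℂ) (1 / 2 : ℂ) = ((1 / 2 : ℝ) : ℂ) := by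
      rw [← Complex.conj_ofReal]; push_cast; rfl
    rw [e]
    change (((1 / 2 : ℝ) : ℂ) * (‖x.1‖ : ℂ) ^ 2).re = _
    rw [← Complex.ofReal_pow, ← Complex.ofReal_mul, Complex.ofReal_re]
  set I : ℝ → ℝ := fun ρ => inner ℝ (-(ρ : ℂ) * dI v₁ ρ + dI v₂ ρ - 1 / 2 * v₁ ρ) (v₁ ρ) +
        inner ℝ (dI v₁ ρ - (ρ : ℂ) * dI v₂ ρ - 1 / 2 * v₂ ρ) (v₂ ρ) with hI
  have c1 : g.fst =ᵐ[μI] fun ρ => -(ρ : ℂ) * dI v₁ ρ + dI v₂ ρ - 1 / 2 * v₁ ρ := by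
    filter_upwards [Lp.coeFn_sub x.2.fst ((1 / 2 : ℂ) • x.1.fst),
      Lp.coeFn_smul (1 / 2 : ℂ) x.1.fst, a1, b1] with ρ e1 e2 e3 e4
    refine e1.trans ?_
    rw [Pi.sub_apply, e2, Pi.smul_apply, e3, e4, smul_eq_mul]
  have c2 : g.snd =ᵐ[μI] fun ρ => dI v₁ ρ - (ρ : ℂ) * dI v₂ ρ - 1 / 2 * v₂ ρ := by
    filter_upwards [Lp.coeFn_sub x.2.snd ((1 / 2 : ℂ) • x.1.snd),
      Lp.coeFn_smul (1 / 2 : ℂ) x.1.snd, a2, b2] with ρ e1 e2 e3 e4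
    refine e1.trans ?_
    rw [Pi.sub_apply, e2, Pi.smul_apply, e3, e4, smul_eq_mul]
  have hae : (fun ρ => inner ℝ (g.fst ρ) (x.1.fst ρ) + inner ℝ (g.snd ρ) (x.1.snd ρ)) =ᵐ[μI] I := by
    filter_upwards [a1, a2, c1, c2] with ρ e1 e2 e3 e4
    rw [e1, e2, e3, e4]
  have hint := (L2I.integrable_real_inner g.fst x.1.fst).add
    (L2I.integrable_real_inner g.snd x.1.snd)
  have hsum : RCLike.re (inner ℂ g x.1) = ∫ ρ, I ρ ∂μI := by
    rw [WithLp.prod_inner_apply, map_add]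
    change RCLike.re (inner ℂ g.fst x.1.fst) + RCLike.re (inner ℂ g.snd x.1.snd) = _
    rw [L2I.re_inner_eq, L2I.re_inner_eq, ← integral_add (L2I.integrable_real_inner _ _)
      (L2I.integrable_real_inner _ _)]
    exact integral_congr_ae hae
  have hII : IntervalIntegrable I volume 0 1 := by
    rw [intervalIntegrable_iff_integrableOn_Ioc_of_le zero_le_one,
      integrableOn_Ioc_iff_integrableOn_Ioo]
    exact hint.congr hae
  have hcont : ContinuousOn (energyFlux v₁ v₂) (Icc 0 1) := by
    have k1 := h₁.continuousOn
    have k2 := h₂.continuousOn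
    unfold energyFlux
    exact ((continuous_id.neg.div_const 2).continuousOn.mul
      ((k1.norm.pow 2).add (k2.norm.pow 2))).add (continuous_inner.comp_continuousOn (k1.prodMk k2))
  have hftc := intervalIntegral.integral_eq_sub_of_hasDerivAt_of_le zero_le_one hcont
    (fun ρ hρ => hasDerivAt_energyFlux h₁ h₂ hρ) hII
  rw [intervalIntegral.integral_of_le zero_le_one, ← restrict_Ioo_eq_restrict_Ioc] at hftc
  have := energyFlux_one_sub_zero_nonpos (v₂ := v₂) h0
  have hle : RCLike.re (inner ℂ g x.1) ≤ 0 := by rw [hsum]; exact hftc.trans_le this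
  linarith

lemma isQuasiDissipative_preGraph : IsQuasiDissipative preGraph (1 / 2) :=
  IsQuasiDissipative.of_re_inner_le fun _ hx => re_inner_le_of_mem_preGraph hx

end Dissipativity

/-! ### The perturbation -/

section Perturbation

instance : IsProbabilityMeasure μI := ⟨by simp⟩

lemma norm_primitive_le (f : L2I) : ‖primitive f‖ ≤ ‖f‖ := by
  have h1 : ∫ ρ, ‖f ρ‖ ∂μI ≤ ‖f‖ := by
    have h2 := eLpNorm_le_eLpNorm_of_exponent_le (p := 1) (q := 2) (by norm_num)
      (Lp.aestronglyMeasurable f)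
    rw [integral_norm_eq_lintegral_enorm (Lp.aestronglyMeasurable f),
      ← eLpNorm_one_eq_lintegral_enorm, Lp.norm_def]
    exact ENNReal.toReal_mono (Lp.eLpNorm_ne_top f) h2
  have h3 : ∀ᵐ ρ ∂μI, ‖primitive f ρ‖ ≤ ‖f‖ := by
    filter_upwards [(L2I.memLp_primitive f).coeFn_toLp, ae_restrict_mem measurableSet_Ioo]
      with ρ h hρ
    have e : primitive f ρ = ∫ ξ in (0 : ℝ)..ρ, f ξ := h
    rw [e]
    refine (intervalIntegral.norm_integral_le_integral_norm hρ.1.le).trans (le_trans ?_ h1)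
    change _ ≤ ∫ ξ in Ioo (0 : ℝ) 1, ‖f ξ‖
    rw [intervalIntegral.integral_of_le hρ.1.le, ← integral_Ioc_eq_integral_Ioo]
    exact setIntegral_mono_set (L2I.integrableOn f).norm
      (Eventually.of_forall fun _ => norm_nonneg _) (Ioc_subset_Ioc_right hρ.2.le).eventuallyLE
  simpa [measureUnivNNReal] using Lp.norm_le_of_ae_bound (norm_nonneg f) h3

lemma c₀_nonneg (p : ℕ) : 0 ≤ c₀ p := by
  unfold c₀; positivity

lemma norm_pertOp_le (p : ℕ) (u : H) : ‖pertOp p u‖ ≤ (p : ℝ) * c₀ p * ‖u‖ := by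
  have hc : 0 ≤ (p : ℝ) * c₀ p := mul_nonneg (Nat.cast_nonneg p) (c₀_nonneg p)
  change ‖WithLp.toLp 2 ((((p : ℝ) * c₀ p : ℝ) : ℂ) • primitive u.snd, (0 : L2I))‖ ≤ _
  rw [WithLp.norm_toLp_fst, norm_smul, Complex.norm_real, Real.norm_eq_abs, abs_of_nonneg hc]
  gcongr
  exact (norm_primitive_le _).trans (WithLp.norm_snd_le _ u)

end Perturbation

/-! ### Elements of the graph, and test functions -/

section TestFunctions

open scoped ContDiff

lemma memLp_of_continuousOn {f : ℝ → ℂ} (hf : ContinuousOn f (Icc 0 1)) : MemLp f 2 μI := by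
  obtain ⟨C, hC⟩ := isCompact_Icc.exists_bound_of_continuousOn hf
  refine MemLp.of_bound
    ((hf.mono Ioo_subset_Icc_self).aestronglyMeasurable measurableSet_Ioo) C ?_
  filter_upwards [ae_restrict_mem measurableSet_Ioo] with ρ hρ
  exact hC ρ (Ioo_subset_Icc_self hρ)

lemma exists_mem_preGraph {v₁ v₂ : ℝ → ℂ} (h₁ : IsC1 v₁) (h₂ : IsC1 v₂) (h0 : v₁ 0 = 0) :
    ∃ x ∈ preGraph, x.1.fst =ᵐ[μI] v₁ ∧ x.1.snd =ᵐ[μI] v₂ ∧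
      (x.2.fst =ᵐ[μI] fun ρ => -(ρ : ℂ) * dI v₁ ρ + dI v₂ ρ) ∧
      (x.2.snd =ᵐ[μI] fun ρ => dI v₁ ρ - (ρ : ℂ) * dI v₂ ρ) := by
  have d₁ : ContinuousOn (dI v₁) (Icc 0 1) :=
    h₁.continuousOn_derivWithin (uniqueDiffOn_Icc zero_lt_one) le_rfl
  have d₂ : ContinuousOn (dI v₂) (Icc 0 1) :=
    h₂.continuousOn_derivWithin (uniqueDiffOn_Icc zero_lt_one) le_rfl
  have hc : ContinuousOn (fun ρ : ℝ => (ρ : ℂ)) (Icc 0 1) := Complex.continuous_ofReal.continuousOn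
  have m₁ := memLp_of_continuousOn h₁.continuousOn
  have m₂ := memLp_of_continuousOn h₂.continuousOn
  have m₃ := memLp_of_continuousOn ((hc.neg.mul d₁).add d₂)
  have m₄ := memLp_of_continuousOn (d₁.sub (hc.mul d₂))
  exact ⟨(WithLp.toLp 2 (m₁.toLp _, m₂.toLp _), WithLp.toLp 2 (m₃.toLp _, m₄.toLp _)),
    ⟨v₁, v₂, h₁, h₂, h0, m₁.coeFn_toLp, m₂.coeFn_toLp, m₃.coeFn_toLp, m₄.coeFn_toLp⟩,
    m₁.coeFn_toLp, m₂.coeFn_toLp, m₃.coeFn_toLp, m₄.coeFn_toLp⟩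

/-- Smooth real functions with compact support in `(0,1)`. -/
structure IsTest (g : ℝ → ℝ) : Prop where
  contDiff : ContDiff ℝ ∞ g
  hasCompactSupport : HasCompactSupport g
  tsupport_subset : tsupport g ⊆ Ioo 0 1

lemma IsTest.isC1 {g : ℝ → ℝ} (hg : IsTest g) : IsC1 fun ρ => (g ρ : ℂ) :=
  (Complex.ofRealCLM.contDiff.comp (hg.contDiff.of_le (by exact_mod_cast le_top))).contDiffOn

lemma IsTest.apply_zero {g : ℝ → ℝ} (hg : IsTest g) : g 0 = 0 :=
  image_eq_zero_of_notMem_tsupport fun h => lt_irrefl _ (hg.tsupport_subset h).1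

lemma IsTest.eventually_eq_zero {g : ℝ → ℝ} (hg : IsTest g) : ∀ᶠ ρ in 𝓝 1, g ρ = 0 :=
  notMem_tsupport_iff_eventuallyEq.1 fun h => lt_irrefl _ (hg.tsupport_subset h).2

lemma L2I.eq_zero_of_forall_isTest {y : L2I}
    (h : ∀ g, IsTest g → ∫ ρ, (g ρ : ℂ) * y ρ ∂μI = 0) : y = 0 := by
  have hi : LocallyIntegrableOn y (Ioo 0 1) μI :=
    ((Lp.memLp y).integrable (by norm_num)).locallyIntegrable.locallyIntegrableOn _
  have h0 := isOpen_Ioo.ae_eq_zero_of_integral_contDiff_smul_eq_zero hi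
    fun g h1 h2 h3 => by simpa [Complex.real_smul] using h g ⟨h1, h2, h3⟩
  refine Lp.eq_zero_iff_ae_eq_zero.2 ?_
  filter_upwards [h0, ae_restrict_mem measurableSet_Ioo] with ρ h1 h2 using h1 h2

lemma L2I.inner_eq_integral_of_ae_eq {f y : L2I} {g : ℝ → ℝ} {c : ℝ}
    (hf : f =ᵐ[μI] fun ρ => (c : ℂ) * g ρ) :
    inner ℂ f y = c * ∫ ρ, (g ρ : ℂ) * y ρ ∂μI := by
  rw [L2.inner_def, ← integral_const_mul]
  refine integral_congr_ae ?_
  filter_upwards [hf] with ρ h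
  rw [h, RCLike.inner_apply, map_mul, Complex.conj_ofReal, Complex.conj_ofReal]
  ring

/-- A subspace of `H` is dense if it contains `(g, 0)` and `(0, g)` for every test function `g`. -/
lemma dense_of_forall_isTest (K : Submodule ℂ H)
    (h : ∀ g, IsTest g → ∀ α β : ℝ, ∃ u ∈ K, (u.fst =ᵐ[μI] fun ρ => (α : ℂ) * g ρ) ∧
      u.snd =ᵐ[μI] fun ρ => (β : ℂ) * g ρ) : Dense (K : Set H) := by
  rw [Submodule.dense_iff_topologicalClosure_eq_top, Submodule.topologicalClosure_eq_top_iff,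
    Submodule.eq_bot_iff]
  intro y hy
  have key : ∀ g, IsTest g → ∀ α β : ℝ, (α : ℂ) * ∫ ρ, (g ρ : ℂ) * y.fst ρ ∂μI +
      β * ∫ ρ, (g ρ : ℂ) * y.snd ρ ∂μI = 0 := by
    intro g hg α β
    obtain ⟨u, hu, h1, h2⟩ := h g hg α β
    have := (Submodule.mem_orthogonal K y).1 hy u hu
    rw [WithLp.prod_inner_apply] at this
    rw [← L2I.inner_eq_integral_of_ae_eq h1, ← L2I.inner_eq_integral_of_ae_eq h2]
    exact this
  have e1 : y.fst = 0 := L2I.eq_zero_of_forall_isTest fun g hg => by simpa using key g hg 1 0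
  have e2 : y.snd = 0 := L2I.eq_zero_of_forall_isTest fun g hg => by simpa using key g hg 0 1
  exact (WithLp.ofLp_eq_zero 2).1 (Prod.ext e1 e2)

lemma dense_domain_preGraph : Dense (Prod.fst '' (preGraph : Set (H × H))) := by
  refine dense_of_forall_isTest (preGraph.map (LinearMap.fst ℂ H H)) fun g hg α β => ?_
  have h : ∀ c : ℝ, IsC1 fun ρ => (c : ℂ) * g ρ := fun c => contDiffOn_const.mul hg.isC1
  obtain ⟨x, hx, h1, h2, -⟩ := exists_mem_preGraph (h α) (h β) (by simp [hg.apply_zero])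
  exact ⟨x.1, ⟨x, hx, rfl⟩, h1, h2⟩

end TestFunctions

/-! ### Density of the range -/

section Range

/-- The equation `n w - (1 - ρ) w' = g` for `u₁ + u₂` is solved by
`w = (1 - ρ)⁻ⁿ ∫_ρ^1 (1 - s)ⁿ⁻¹ g(s) ds`, which vanishes near the singular point `ρ = 1`. -/
lemma exists_isC1_of_isTest {g : ℝ → ℝ} (hg : IsTest g) (m : ℕ) :
    ∃ w : ℝ → ℂ, IsC1 w ∧
      ∀ ρ ∈ Ioo (0 : ℝ) 1, ((m + 1 : ℕ) : ℂ) * w ρ - (1 - ρ) * dI w ρ = g ρ := by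
  set k : ℝ → ℂ := fun s => (1 - (s : ℂ)) ^ m * g s with hk
  have hkc : Continuous k := by
    have := hg.contDiff.continuous
    fun_prop
  set F : ℝ → ℂ := fun ρ => ∫ s in ρ..1, k s with hF
  have hFd : ∀ ρ, HasDerivAt F (-k ρ) ρ := fun ρ =>
    intervalIntegral.integral_hasDerivAt_left (hkc.intervalIntegrable _ _)
      (hkc.stronglyMeasurableAtFilter _ _) hkc.continuousAt
  have hF1 : ContDiff ℝ 1 F := by
    refine contDiff_one_iff_deriv.2 ⟨fun ρ => (hFd ρ).differentiableAt, ?_⟩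
    rw [show deriv F = fun ρ => -k ρ from funext fun ρ => (hFd ρ).deriv]
    exact hkc.neg
  have hF0 : ∀ᶠ ρ in 𝓝 1, F ρ = 0 := by
    obtain ⟨δ, hδ, h⟩ := Metric.eventually_nhds_iff_ball.1 hg.eventually_eq_zero
    refine Metric.eventually_nhds_iff_ball.2 ⟨δ, hδ, fun ρ hρ => ?_⟩
    refine (intervalIntegral.integral_congr fun s hs => ?_).trans intervalIntegral.integral_zero
    have hs' : s ∈ Metric.ball (1 : ℝ) δ :=
      (convex_ball (1 : ℝ) δ).ordConnected.uIcc_subset hρ (Metric.mem_ball_self hδ) hs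
    simp [hk, h s hs']
  set q : ℝ → ℂ := fun ρ => (1 - (ρ : ℂ)) ^ (m + 1) with hq
  have hq1 : ContDiff ℝ 1 q := (contDiff_const.sub Complex.ofRealCLM.contDiff).pow _
  have hq0 : ∀ ρ : ℝ, ρ ≠ 1 → (1 - (ρ : ℂ)) ≠ 0 := fun ρ hρ h =>
    hρ (by exact_mod_cast (sub_eq_zero.1 h).symm)
  have hqd : ∀ ρ : ℝ, HasDerivAt q (-(((m + 1 : ℕ) : ℂ) * (1 - (ρ : ℂ)) ^ m)) ρ := fun ρ => by
    have := ((Complex.ofRealCLM.hasDerivAt (x := ρ)).const_sub 1).pow (m + 1)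
    refine HasDerivAt.congr_deriv this ?_
    simp
  refine ⟨fun ρ => F ρ / q ρ, ?_, fun ρ hρ => ?_⟩
  · refine ContDiff.contDiffOn (contDiff_iff_contDiffAt.2 fun ρ => ?_)
    rcases eq_or_ne ρ 1 with rfl | hρ
    · refine (contDiffAt_const (c := (0 : ℂ))).congr_of_eventuallyEq ?_
      filter_upwards [hF0] with s hs
      rw [hs, zero_div]
    · simp only [div_eq_mul_inv]
      exact hF1.contDiffAt.mul (hq1.contDiffAt.inv (pow_ne_zero _ (hq0 ρ hρ)))
  · have h1 := hq0 ρ hρ.2.ne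
    have hd := (hFd ρ).div (hqd ρ) (pow_ne_zero _ h1)
    have e : dI (fun ρ => F ρ / q ρ) ρ = _ :=
      (derivWithin_of_mem_nhds (Icc_mem_nhds hρ.1 hρ.2)).trans hd.deriv
    rw [e]
    simp only [hq, hk]
    field_simp
    ring

/-- The equation `n w + (1 + ρ) w' = g` for `u₁ - u₂` is regular on `[0,1]` and can be solved with
any initial value. -/
lemma exists_isC1_of_isTest_of_initial {g : ℝ → ℝ} (hg : IsTest g) (m : ℕ) (b c : ℂ) :
    ∃ w : ℝ → ℂ, IsC1 w ∧ w 0 = c ∧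
      ∀ ρ ∈ Ioo (0 : ℝ) 1, ((m + 1 : ℕ) : ℂ) * w ρ + (1 + ρ) * dI w ρ = b * g ρ := by
  set k : ℝ → ℂ := fun s => b * ((1 + (s : ℂ)) ^ m * g s) with hk
  have hkc : Continuous k := by
    have := hg.contDiff.continuous
    fun_prop
  set F : ℝ → ℂ := fun ρ => c + ∫ s in (0 : ℝ)..ρ, k s with hF
  have hFd : ∀ ρ, HasDerivAt F (k ρ) ρ := fun ρ =>
    (intervalIntegral.integral_hasDerivAt_right (hkc.intervalIntegrable _ _)
      (hkc.stronglyMeasurableAtFilter _ _) hkc.continuousAt).const_add c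
  have hF1 : ContDiff ℝ 1 F := by
    refine contDiff_one_iff_deriv.2 ⟨fun ρ => (hFd ρ).differentiableAt, ?_⟩
    rw [show deriv F = k from funext fun ρ => (hFd ρ).deriv]
    exact hkc
  set q : ℝ → ℂ := fun ρ => (1 + (ρ : ℂ)) ^ (m + 1) with hq
  have hq1 : ContDiff ℝ 1 q := (contDiff_const.add Complex.ofRealCLM.contDiff).pow _
  have hq0 : ∀ ρ : ℝ, 0 ≤ ρ → (1 + (ρ : ℂ)) ≠ 0 := fun ρ hρ h => by
    have : (1 + ρ : ℝ) = 0 := by exact_mod_cast h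
    linarith
  have hqd : ∀ ρ : ℝ, HasDerivAt q (((m + 1 : ℕ) : ℂ) * (1 + (ρ : ℂ)) ^ m) ρ := fun ρ => by
    have := ((Complex.ofRealCLM.hasDerivAt (x := ρ)).const_add 1).pow (m + 1)
    refine HasDerivAt.congr_deriv this ?_
    simp
  refine ⟨fun ρ => F ρ / q ρ, ?_, by simp [hF, hq], fun ρ hρ => ?_⟩
  · simp only [div_eq_mul_inv]
    exact hF1.contDiffOn.mul (hq1.contDiffOn.inv fun ρ hρ => pow_ne_zero _ (hq0 ρ hρ.1))
  · have h1 := hq0 ρ hρ.1.le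
    have hd := (hFd ρ).div (hqd ρ) (pow_ne_zero _ h1)
    have e : dI (fun ρ => F ρ / q ρ) ρ = _ :=
      (derivWithin_of_mem_nhds (Icc_mem_nhds hρ.1 hρ.2)).trans hd.deriv
    rw [e]
    simp only [hq, hk]
    field_simp
    ring

/-- In the characteristic variables `u₁ ± u₂` the equation `n u - L̃₀ u = f` decouples, up to the
boundary condition `u₁(0) = 0`, which fixes the initial value of `u₁ - u₂`. -/
lemma dense_range_preGraph (m : ℕ) :
    Dense ((fun x : H × H => ((m + 1 : ℕ) : ℂ) • x.1 - x.2) '' (preGraph : Set (H × H))) := by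
  refine dense_of_forall_isTest
    (preGraph.map (((m + 1 : ℕ) : ℂ) • LinearMap.fst ℂ H H - LinearMap.snd ℂ H H))
    fun g hg α β => ?_
  obtain ⟨P, hP, hPe⟩ := exists_isC1_of_isTest hg m
  obtain ⟨Q, hQ, hQ0, hQe⟩ := exists_isC1_of_isTest_of_initial hg m (α - β) (-((α + β) * P 0))
  have hP' : IsC1 (((α : ℂ) + β) • P) := contDiffOn_const.smul hP
  have hQ' : IsC1 ((-1 : ℂ) • Q) := contDiffOn_const.smul hQ
  have hPQ : IsC1 (((α : ℂ) + β) • P + Q) := hP'.add hQ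
  have hPQ' : IsC1 (((α : ℂ) + β) • P + (-1 : ℂ) • Q) := hP'.add hQ'
  obtain ⟨x, hx, a1, a2, b1, b2⟩ := exists_mem_preGraph
    (v₁ := (1 / 2 : ℂ) • (((α : ℂ) + β) • P + Q))
    (v₂ := (1 / 2 : ℂ) • (((α : ℂ) + β) • P + (-1 : ℂ) • Q))
    (contDiffOn_const.smul hPQ) (contDiffOn_const.smul hPQ')
    (by simp [hQ0])
  refine ⟨((m + 1 : ℕ) : ℂ) • x.1 - x.2, ⟨x, hx, rfl⟩, ?_, ?_⟩
  · filter_upwards [Lp.coeFn_sub (((m + 1 : ℕ) : ℂ) • x.1.fst) x.2.fst,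
      Lp.coeFn_smul ((m + 1 : ℕ) : ℂ) x.1.fst, a1, b1, ae_restrict_mem measurableSet_Ioo]
      with ρ e1 e2 e3 e4 hρ
    refine e1.trans ?_
    rw [Pi.sub_apply, e2, Pi.smul_apply, e3, e4, dI_smul _ hPQ hρ,
      dI_smul _ hPQ' hρ, dI_add hP' hQ hρ, dI_add hP' hQ' hρ, dI_smul _ hP hρ,
      dI_smul _ hQ hρ]
    simp only [Pi.smul_apply, Pi.add_apply, smul_eq_mul]
    linear_combination ((α : ℂ) + β) / 2 * hPe ρ hρ + 1 / 2 * hQe ρ hρ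
  · filter_upwards [Lp.coeFn_sub (((m + 1 : ℕ) : ℂ) • x.1.snd) x.2.snd,
      Lp.coeFn_smul ((m + 1 : ℕ) : ℂ) x.1.snd, a2, b2, ae_restrict_mem measurableSet_Ioo]
      with ρ e1 e2 e3 e4 hρ
    refine e1.trans ?_
    rw [Pi.sub_apply, e2, Pi.smul_apply, e3, e4, dI_smul _ hPQ hρ,
      dI_smul _ hPQ' hρ, dI_add hP' hQ hρ, dI_add hP' hQ' hρ, dI_smul _ hP hρ,
      dI_smul _ hQ hρ]
    simp only [Pi.smul_apply, Pi.add_apply, smul_eq_mul]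
    linear_combination ((α : ℂ) + β) / 2 * hPe ρ hρ - 1 / 2 * hQe ρ hρ

end Range

/-! ### The generator -/

section Generator

lemma preFreeOp_isClosable : preFreeOp.IsClosable := by
  refine ⟨preGraph.topologicalClosure.toLinearPMap, ?_⟩
  rw [preFreeOp_graph, Submodule.toLinearPMap_graph_eq]
  rintro ⟨x, y⟩ hx rfl
  exact isQuasiDissipative_preGraph.eq_zero_of_mem_topologicalClosure dense_domain_preGraph hx

lemma freeOp_graph : freeOp.graph = preGraph.topologicalClosure := by
  rw [freeOp, ← preFreeOp_isClosable.graph_closure_eq_closure_graph, preFreeOp_graph]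

/-- The bounded operator `L'`. -/
noncomputable def pertCLM (p : ℕ) : H →L[ℂ] H :=
  (pertOp p).mkContinuous ((p : ℝ) * c₀ p) (norm_pertOp_le p)

lemma norm_pertCLM_le (p : ℕ) : ‖pertCLM p‖ ≤ (p : ℝ) * c₀ p :=
  LinearMap.mkContinuous_norm_le _ (mul_nonneg (Nat.cast_nonneg p) (c₀_nonneg p)) _

lemma mem_linOp_graph_iff (p : ℕ) (x z : H) :
    (x, z) ∈ (linOp p).graph ↔ (x, z - pertCLM p x) ∈ preGraph.topologicalClosure := by
  rw [← freeOp_graph, LinearPMap.mem_graph_iff, LinearPMap.mem_graph_iff]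
  constructor
  · rintro ⟨y, rfl, rfl⟩
    exact ⟨y, rfl, (add_sub_cancel_left (pertOp p y) (freeOp y)).symm⟩
  · rintro ⟨y, rfl, h⟩
    exact ⟨y, rfl, (congrArg (pertOp p y + ·) h).trans (add_sub_cancel (pertOp p y) z)⟩

lemma dense_domain_linOp (p : ℕ) : Dense (Prod.fst '' ((linOp p).graph : Set (H × H))) := by
  refine dense_domain_preGraph.mono ?_
  rintro _ ⟨x, hx, rfl⟩
  refine ⟨(x.1, x.2 + pertCLM p x.1), (mem_linOp_graph_iff p _ _).2 ?_, rfl⟩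
  rw [add_sub_cancel_right]
  exact preGraph.le_topologicalClosure hx

lemma exists_c0Semigroup_linOp (p : ℕ) : ∃ S : ℝ≥0 → H →L[ℂ] H,
    IsC0Semigroup S ∧ IsGenerator (linOp p) S ∧
      ∀ τ : ℝ≥0, ‖S τ‖ ≤ Real.exp ((1 / 2 + (p : ℝ) * c₀ p) * (τ : ℝ)) := by
  have hc : 0 ≤ (p : ℝ) * c₀ p := mul_nonneg (Nat.cast_nonneg p) (c₀_nonneg p)
  have hG := isQuasiDissipative_preGraph.topologicalClosure
  refine exists_c0Semigroup_of_isQuasiDissipative (by positivity)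
    (hG.of_perturbation (norm_pertCLM_le p) (mem_linOp_graph_iff p)) (dense_domain_linOp p) ?_
  filter_upwards [tendsto_natCast_atTop_atTop.eventually_gt_atTop (1 / 2 + (p : ℝ) * c₀ p)]
    with n hn
  have hn' : (1 / 2 : ℝ) < n := by linarith
  obtain ⟨m, rfl⟩ : ∃ m, n = m + 1 :=
    Nat.exists_eq_succ_of_ne_zero (by rintro rfl; norm_num at hn')
  refine hG.exists_of_perturbation (norm_pertCLM_le p) (mem_linOp_graph_iff p) hn
    (hG.exists_of_dense_range preGraph.isClosed_topologicalClosure hn' ?_)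
  rw [Complex.ofReal_natCast]
  exact (dense_range_preGraph m).mono (image_mono preGraph.le_topologicalClosure)

end Generator

end SelfSimilarWave

theorem mainTheorem7 (p : ℕ) (hp : 1 < p) (hodd : Odd p) :
    SelfSimilarWave.preFreeOp.IsClosable ∧
    (∃ B : SelfSimilarWave.H →L[ℂ] SelfSimilarWave.H,
      (B : SelfSimilarWave.H →ₗ[ℂ] SelfSimilarWave.H) = SelfSimilarWave.pertOp p ∧
      ‖B‖ ≤ (p : ℝ) * SelfSimilarWave.c₀ p) ∧
    ∃ S : ℝ≥0 → SelfSimilarWave.H →L[ℂ] SelfSimilarWave.H,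
      SelfSimilarWave.IsC0Semigroup S ∧
      SelfSimilarWave.IsGenerator (SelfSimilarWave.linOp p) S ∧
      ∀ τ : ℝ≥0, ‖S τ‖ ≤ Real.exp ((1 / 2 + (p : ℝ) * SelfSimilarWave.c₀ p) * (τ : ℝ)) :=
  ⟨SelfSimilarWave.preFreeOp_isClosable,
    ⟨SelfSimilarWave.pertCLM p, rfl, SelfSimilarWave.norm_pertCLM_le p⟩,
    SelfSimilarWave.exists_c0Semigroup_linOp p⟩
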